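/- Let $d\ge 1$ be an integer, $\alpha\in(0,1)$ and $\beta\in(0,2]$. For $t>0$ and $x\in\mathbb{R}^d\setminus\{0\}$ let \[ Z(t,x)=\pi^{-d/2}|x|^{-d}\,H^{12}_{32}\Big[2^\beta t^\alpha|x|^{-\beta}\,\Big|\,\begin{smallmatrix}(1-\frac d2,\frac\beta2),&(0,1),&(0,\frac\beta2)\\ (0,1),&(0,\alpha)&\end{smallmatrix}\Big] =\frac{\pi^{-d/2}|x|^{-d}}{2\pi i}\int_{c-i\infty}^{c+i\infty}\frac{\Gamma(s)\,\Gamma(\frac d2-\frac\beta2 s)\,\Gamma(1-s)}{\Gamma(\frac\beta2 s)\,\Gamma(1-\alpha s)}\,\big(2^\beta t^\alpha|x|^{-\beta}\big)^{-s}\,ds , \] where $0<c<\min\{1,d/\beta\}$ (so that the line $\operatorname{Re}s=c$ separates the poles of $\Gamma(s)$ from those of $\Gamma(\frac d2-\frac\beta2 s)\Gamma(1-s)$), be the fundamental solution of the Cauchy problem \[ \partial_t^\alpha(u-u_0)+(-\Delta)^{\beta/2}u=f\ \text{ in }(0,\infty)\times\mathbb{R}^d,\qquad u(0,\cdot)=u_0,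 \] with $\partial_t^\alpha$ the Riemann--Liouville derivative. Let $u_0\in L^1(\mathbb{R}^d)\cap L^2(\mathbb{R}^d)$ and let \[ u(t,x)=\int_{\mathbb{R}^d}Z(t,x-y)\,u_0(y)\,dy \] be the mild solution of this problem with $f\equiv 0$. Then for every $t>0$ the integral converges absolutely for almost every $x\in\mathbb{R}^d$, $u(t,\cdot)$ is measurable, and there is a constant $C>0$, depending only on $\alpha$, $\beta$ and $d$, such that for all $t>0$ \[ \|u(t,\cdot)\|_{L^2}\le C\,\big(\|u_0\|_{L^1}+\|u_0\|_{L^2}\big)\,t^{-\alpha\min\{1,\,d/(2\beta)\}}\qquad\text{if } d\neq 2\beta, \] \[ \|u(t,\cdot)\|_{L^{2,\infty}}\le C\,\big(\|u_0\|_{L^1}+\|u_0\|_{L^2}\big)\,t^{-\alpha}\qquad\text{if } d=2\beta, \] where $\|g\|_{L^{2,\infty}}=\sup_{r>0}\,r\,\big|\{x\in\mathbb{R}^d:\ |g(x)|>r\}\big|^{1/2}$. -/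

import Mathlib

open MeasureTheory
open scoped ENNReal NNReal

noncomputable section

namespace FullyNonlocal

/-! Fox H-functions. The parameters are the pairs `(a_i, α_i)` in `a` and `(b_j, β_j)` in `b`. -/

/-- The Mellin symbol
`∏_{j ≤ m} Γ(b_j + β_j s) ∏_{i ≤ n} Γ(1 - a_i - α_i s) /
  (∏_{i > n} Γ(a_i + α_i s) ∏_{j > m} Γ(1 - b_j - β_j s))`
of the Fox H-function `H^{mn}_{pq}`. -/
def foxSymbol (m n : ℕ) (a b : List (ℝ × ℝ)) (s : ℂ) : ℂ :=
  (((b.take m).map fun p => Complex.Gamma (p.1 + p.2 * s)).prod *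
      ((a.take n).map fun p => Complex.Gamma (1 - p.1 - p.2 * s)).prod) /
    (((a.drop n).map fun p => Complex.Gamma (p.1 + p.2 * s)).prod *
      ((b.drop m).map fun p => Complex.Gamma (1 - p.1 - p.2 * s)).prod)

/-- The vertical line `Re s = c` separates the poles `(-b_j - l) / β_j`, `j ≤ m`, which lie to its
left, from the poles `(1 - a_i + k) / α_i`, `i ≤ n`, which lie to its right. -/
def SeparatesPoles (m n : ℕ) (a b : List (ℝ × ℝ)) (c : ℝ) : Prop :=
  (∀ p ∈ b.take m, ∀ l : ℕ, (-p.1 - l) / p.2 < c) ∧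
    (∀ p ∈ a.take n, ∀ k : ℕ, c < (1 - p.1 + k) / p.2)

/-- The Fox H-function at `z > 0` as the Mellin-Barnes integral `(2πi)⁻¹ ∫ 𝓗(s) z^{-s} ds` along
the vertical line `Re s = c`, which has to separate the poles. -/
def foxH (m n : ℕ) (a b : List (ℝ × ℝ)) (c z : ℝ) : ℂ :=
  mellinInv c (foxSymbol m n a b) z

/-! The matrix of fundamental solutions of `∂_t^α (u - u₀) + (-Δ)^{β/2} u = f` on `ℝ^d`. -/

/-- Upper parameters of the H-functions of `Z` and `Y`. -/
def paramA (β : ℝ) (d : ℕ) : List (ℝ × ℝ) := [(1 - d / 2, β / 2), (0, 1), (0, β / 2)]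

/-- Lower parameters of the H-function of `Z`. -/
def paramZ (α : ℝ) : List (ℝ × ℝ) := [(0, 1), (0, α)]

/-- Lower parameters of the H-function of `Y`. -/
def paramY (α : ℝ) : List (ℝ × ℝ) := [(0, 1), (1 - α, α)]

/-- Abscissa of the contour: the middle of the strip `0 < Re s < min {1, d / β}` between the two
families of poles. -/
def contour (β : ℝ) (d : ℕ) : ℝ := min 1 (d / β) / 2

theorem contour_separates_aux {β : ℝ} (hβ : 0 < β) {d : ℕ} (hd : 1 ≤ d) (q : ℝ × ℝ) :
    SeparatesPoles 1 2 (paramA β d) [(0, 1), q] (contour β d) := by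
  have hd' : (0 : ℝ) < d := by exact_mod_cast hd
  have hpos : 0 < min 1 ((d : ℝ) / β) := lt_min one_pos (by positivity)
  have h1 : min 1 ((d : ℝ) / β) ≤ 1 := min_le_left _ _
  have h2 : min 1 ((d : ℝ) / β) ≤ d / β := min_le_right _ _
  refine ⟨?_, ?_⟩
  · intro p hp l
    have : p = (0, 1) := by simpa using hp
    subst this
    have hl : (0 : ℝ) ≤ l := Nat.cast_nonneg l
    simp only [contour]
    linarith
  · intro p hp k
    have hk : (0 : ℝ) ≤ k := Nat.cast_nonneg k
    have : p = (1 - (d : ℝ) / 2, β / 2) ∨ p = (0, 1) := by simpa [paramA] using hp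
    rcases this with rfl | rfl
    · have h3 : (d : ℝ) / β ≤ (1 - (1 - (d : ℝ) / 2) + k) / (β / 2) := by
        rw [div_le_div_iff₀ hβ (by positivity)]
        nlinarith [mul_nonneg hk hβ.le]
      simp only [contour]
      linarith
    · simp only [contour]
      linarith

theorem contour_separates_Z (α : ℝ) {β : ℝ} (hβ : 0 < β) {d : ℕ} (hd : 1 ≤ d) :
    SeparatesPoles 1 2 (paramA β d) (paramZ α) (contour β d) :=
  contour_separates_aux hβ hd _

theorem contour_separates_Y (α : ℝ) {β : ℝ} (hβ : 0 < β) {d : ℕ} (hd : 1 ≤ d) :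
    SeparatesPoles 1 2 (paramA β d) (paramY α) (contour β d) :=
  contour_separates_aux hβ hd _

/-- The fundamental solution `Z(t, x) = π^{-d/2} |x|^{-d} H^{12}_{32}[2^β t^α |x|^{-β}]`. -/
def fundZ (α β : ℝ) {d : ℕ} (t : ℝ) (x : EuclideanSpace ℝ (Fin d)) : ℂ :=
  ((Real.pi ^ (-(d : ℝ) / 2) * ‖x‖ ^ (-(d : ℝ)) : ℝ) : ℂ) *
    foxH 1 2 (paramA β d) (paramZ α) (contour β d) (2 ^ β * t ^ α * ‖x‖ ^ (-β))

/-- The fundamental solution `Y(t, x) = π^{-d/2} t^{α-1} |x|^{-d} H^{12}_{32}[2^β t^α |x|^{-β}]`. -/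
def fundY (α β : ℝ) {d : ℕ} (t : ℝ) (x : EuclideanSpace ℝ (Fin d)) : ℂ :=
  ((Real.pi ^ (-(d : ℝ) / 2) * t ^ (α - 1) * ‖x‖ ^ (-(d : ℝ)) : ℝ) : ℂ) *
    foxH 1 2 (paramA β d) (paramY α) (contour β d) (2 ^ β * t ^ α * ‖x‖ ^ (-β))

/-- The mild solution
`u(t, x) = ∫ Z(t, x - y) u₀(y) dy + ∫_0^t ∫ Y(t - s, x - y) f(s, y) dy ds`;
it is meaningful at `(t, x)` if `MildDefinedAt` holds there. -/
def mildSolution (α β : ℝ) {d : ℕ} (u₀ : EuclideanSpace ℝ (Fin d) → ℂ)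
    (f : ℝ → EuclideanSpace ℝ (Fin d) → ℂ) (t : ℝ) (x : EuclideanSpace ℝ (Fin d)) : ℂ :=
  (∫ y, fundZ α β t (x - y) * u₀ y) +
    ∫ s in (0 : ℝ)..t, ∫ y, fundY α β (t - s) (x - y) * f s y

/-- The integrals that define the mild solution at `(t, x)`, `t > 0`, converge absolutely. -/
def MildDefinedAt (α β : ℝ) {d : ℕ} (u₀ : EuclideanSpace ℝ (Fin d) → ℂ)
    (f : ℝ → EuclideanSpace ℝ (Fin d) → ℂ) (t : ℝ) (x : EuclideanSpace ℝ (Fin d)) : Prop :=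
  Integrable (fun y => fundZ α β t (x - y) * u₀ y) volume ∧
    Integrable (fun p : ℝ × EuclideanSpace ℝ (Fin d) => fundY α β (t - p.1) (x - p.2) * f p.1 p.2)
      ((volume.restrict (Set.Ioc 0 t)).prod volume)

/-- The weak Lebesgue quasinorm `‖g‖_{L^{p,∞}} = sup_{r > 0} r |{|g| > r}|^{1/p}`. -/
def weakLpNorm {d : ℕ} (g : EuclideanSpace ℝ (Fin d) → ℂ) (p : ℝ) : ℝ≥0∞ :=
  ⨆ r : ℝ≥0, (r : ℝ≥0∞) * volume {x | r < ‖g x‖₊} ^ (1 / p)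

end FullyNonlocal

end

/-! Everything rests on pointwise bounds `|Z(t, x)| ≤ C t^{-αc} |x|^{βc - d}`, and `c` is the
abscissa of the Mellin-Barnes contour: on `Re s = c` one has `|z^{-s}| = z^{-c}`, so an integrable
symbol gives `|H(z)| ≤ C z^{-c}`, and `z = 2^β t^α |x|^{-β}` turns this into the bound on `Z`.

The symbol decays exponentially on vertical lines with `0 < Re s < d/β`. Indeed `Γ(s)Γ(1 - s)`
contributes `e^{-π|Im s|}`, `1/Γ(1 - αs)` at most `e^{πα|Im s|}`, and the quotient `Γ(d/2 -
βs/2)/Γ(βs/2)` only a polynomial factor; `α < 1` leaves decay (`exists_norm_foxSymbol_Z_le`).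
Cauchy's theorem then allows every `c` with `0 < c < min(1, d/β)`. If `2β ≤ d`, the pole at `s = 1`
can be crossed as well, which yields the endpoint `c = 1` (`exists_norm_foxH_Z_le_inv`).

Three cases remain (`exists_mildSolution_bound`). For `d < 2β`, exponents on either side of `d/(2β)`
put `Z(t)` in `L²`, and Young's inequality uses `u₀ ∈ L¹`. For `d > 2β`, `|x|^{β-d}` is integrable
near the origin and square integrable away from it, so the near part acts on `u₀ ∈ L²` and the far
part on `u₀ ∈ L¹`. For `d = 2β` the kernel is `|x|^{-d/2}`, just outside `L²`, and only a weak type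
bound holds by this argument. -/

noncomputable section

namespace FullyNonlocal

/-! ### Convolution of nonnegative functions and Young's inequality -/

section Convolution

set_option linter.unusedSectionVars false

variable {G : Type*} [AddCommGroup G] [MeasurableSpace G] [MeasurableAdd₂ G] [MeasurableNeg G]

/-- The convolution of nonnegative functions. -/
def lconv (μ : Measure G) (K g : G → ℝ≥0∞) (x : G) : ℝ≥0∞ := ∫⁻ y, K (x - y) * g y ∂μ

variable {μ : Measure G} {K K' g : G → ℝ≥0∞}

theorem measurable_lconv [SFinite μ] (hK : Measurable K) (hg : Measurable g) :
    Measurable (lconv μ K g) :=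
  Measurable.lintegral_prod_right' (f := fun p : G × G => K (p.1 - p.2) * g p.2)
    ((hK.comp (measurable_fst.sub measurable_snd)).mul (hg.comp measurable_snd))

theorem lconv_comm [μ.IsAddLeftInvariant] [μ.IsNegInvariant] :
    lconv μ K g = lconv μ g K := by
  funext x
  unfold lconv
  rw [← lintegral_sub_left_eq_self (fun y => K (x - y) * g y) x]
  simp [mul_comm]

theorem lconv_add (hK : Measurable K) (hg : Measurable g) :
    lconv μ (K + K') g = lconv μ K g + lconv μ K' g := by
  funext x
  simp only [lconv, Pi.add_apply]
  simp_rw [add_mul]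
  exact lintegral_add_left (by fun_prop) _

theorem lintegral_lconv [SFinite μ] [μ.IsAddLeftInvariant] (hK : Measurable K)
    (hg : Measurable g) : ∫⁻ x, lconv μ K g x ∂μ = (∫⁻ x, K x ∂μ) * ∫⁻ x, g x ∂μ := by
  unfold lconv
  rw [lintegral_lintegral_swap]
  · have h (y : G) : ∫⁻ x, K (x - y) * g y ∂μ = (∫⁻ x, K x ∂μ) * g y := by
      rw [lintegral_mul_const _ (by fun_prop),
        lintegral_sub_right_eq_self]
    simp_rw [h]
    rw [lintegral_const_mul _ hg]
  · exact ((hK.comp (measurable_fst.sub measurable_snd)).mul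
      (hg.comp measurable_snd)).aemeasurable

/-- Cauchy-Schwarz for the functions `1` and `g` with respect to the measure `k dμ`. -/
theorem sq_lintegral_mul_le {k : G → ℝ≥0∞} (hk : Measurable k) (hg : Measurable g) :
    (∫⁻ y, k y * g y ∂μ) ^ 2 ≤ (∫⁻ y, k y ∂μ) * ∫⁻ y, k y * g y ^ 2 ∂μ := by
  have h := ENNReal.lintegral_mul_le_Lp_mul_Lq (μ.withDensity k) Real.HolderConjugate.two_two
    (f := fun _ => 1) (g := g) aemeasurable_const hg.aemeasurable
  have h2 := pow_le_pow_left' h 2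
  have hc (a : ℝ≥0∞) : (a ^ (1 / 2 : ℝ)) ^ 2 = a := by
    rw [← ENNReal.rpow_natCast, ← ENNReal.rpow_mul]; norm_num
  rw [mul_pow, hc, hc] at h2
  simpa [lintegral_withDensity_eq_lintegral_mul, hk, hg,
    lintegral_withDensity_eq_lintegral_mul μ hk (hg.pow_const 2)] using h2

/-- Young's inequality `L¹ * L² ⊆ L²`. -/
theorem lintegral_lconv_sq_le [SFinite μ] [μ.IsAddLeftInvariant] [μ.IsNegInvariant]
    (hK : Measurable K) (hg : Measurable g) :
    ∫⁻ x, lconv μ K g x ^ 2 ∂μ ≤ (∫⁻ x, K x ∂μ) ^ 2 * ∫⁻ x, g x ^ 2 ∂μ := by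
  have h (x : G) : lconv μ K g x ^ 2 ≤ (∫⁻ x, K x ∂μ) * lconv μ K (fun y => g y ^ 2) x := by
    refine (sq_lintegral_mul_le (hK.comp (measurable_const.sub measurable_id)) hg).trans_eq ?_
    rw [← lintegral_sub_left_eq_self K x]
    rfl
  refine (lintegral_mono h).trans_eq ?_
  rw [lintegral_const_mul _ (measurable_lconv hK (hg.pow_const 2)),
    lintegral_lconv hK (hg.pow_const 2), sq, mul_assoc]

/-- Young's inequality `L¹ * L² ⊆ L²`. -/
theorem eLpNorm_lconv_le [SFinite μ] [μ.IsAddLeftInvariant] [μ.IsNegInvariant]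
    (hK : Measurable K) (hg : Measurable g) :
    eLpNorm (lconv μ K g) 2 μ ≤ eLpNorm K 1 μ * eLpNorm g 2 μ := by
  have h := lintegral_lconv_sq_le (μ := μ) hK hg
  have h2 := ENNReal.rpow_le_rpow h (show (0 : ℝ) ≤ 1 / 2 by norm_num)
  have hc (a : ℝ≥0∞) : (a ^ 2) ^ (1 / 2 : ℝ) = a := by
    rw [← ENNReal.rpow_natCast, ← ENNReal.rpow_mul]; norm_num
  rw [ENNReal.mul_rpow_of_nonneg _ _ (by norm_num), hc] at h2
  simpa [eLpNorm_eq_lintegral_rpow_enorm_toReal] using h2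

theorem lconv_le_mul_lintegral {A : ℝ≥0∞} (hg : Measurable g) (hK : ∀ x, K x ≤ A) (x : G) :
    lconv μ K g x ≤ A * ∫⁻ y, g y ∂μ := by
  rw [← lintegral_const_mul _ hg]
  exact lintegral_mono fun _ => mul_le_mul_left (hK _) _

theorem lconv_congr_ae {g' : G → ℝ≥0∞} (h : g =ᵐ[μ] g') : lconv μ K g = lconv μ K g' := by
  funext x
  exact lintegral_congr_ae (h.mono fun y hy => by simp only [hy])

end Convolution

/-! ### Integrals of powers of the norm over balls and their complements -/

section Powers

variable {d : ℕ}

/-- Polar coordinates. The radial set `S` is kept general to serve balls and their complements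
alike. -/
theorem lintegral_indicator_norm_rpow (hd : 1 ≤ d) {p : ℝ} {S : Set ℝ} (hS : MeasurableSet S)
    (hI : IntegrableOn (fun y : ℝ => y ^ (p + d - 1)) (S ∩ Set.Ioi 0)) :
    ∫⁻ x : EuclideanSpace ℝ (Fin d),
        S.indicator (fun y => ENNReal.ofReal (y ^ p)) ‖x‖ =
      ENNReal.ofReal (d * volume.real (Metric.ball (0 : EuclideanSpace ℝ (Fin d)) 1) *
        ∫ y in S ∩ Set.Ioi 0, y ^ (p + d - 1)) := by
  have : Nontrivial (EuclideanSpace ℝ (Fin d)) := by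
    have : Nonempty (Fin d) := ⟨⟨0, hd⟩⟩
    infer_instance
  set f : ℝ → ℝ := S.indicator (fun y => y ^ p) with hf
  have hcong : ∀ y ∈ Set.Ioi (0 : ℝ), y ^ (d - 1) • f y =
      S.indicator (fun y => y ^ (p + d - 1)) y := by
    intro y hy
    by_cases h : y ∈ S
    · have : ((d - 1 : ℕ) : ℝ) = d - 1 := by push_cast [hd]; ring
      rw [hf, Set.indicator_of_mem h, Set.indicator_of_mem h, smul_eq_mul,
        ← Real.rpow_natCast, ← Real.rpow_add hy, this]
      ring_nf
    · simp [hf, h]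
  have hint : Integrable (fun x : EuclideanSpace ℝ (Fin d) => f ‖x‖) := by
    rw [integrable_fun_norm_addHaar, finrank_euclideanSpace_fin,
      integrableOn_congr_fun hcong measurableSet_Ioi, IntegrableOn,
      integrable_indicator_iff hS, IntegrableOn, Measure.restrict_restrict hS]
    exact hI
  have hval := integral_fun_norm_addHaar (volume : Measure (EuclideanSpace ℝ (Fin d))) f
  rw [finrank_euclideanSpace_fin, setIntegral_congr_fun measurableSet_Ioi hcong,
    integral_indicator hS, Measure.restrict_restrict hS, nsmul_eq_mul, smul_eq_mul,
    ← mul_assoc] at hval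
  rw [← hval, ofReal_integral_eq_lintegral_ofReal hint]
  · congr 1; funext x
    by_cases h : ‖x‖ ∈ S <;> simp [hf, h]
  · refine Filter.Eventually.of_forall fun x => ?_
    exact Set.indicator_apply_nonneg fun _ => by positivity

theorem exists_lintegral_norm_rpow_Iic_le (hd : 1 ≤ d) {p : ℝ} (hp : -(d : ℝ) < p) :
    ∃ A : ℝ, 0 < A ∧ ∀ R : ℝ, 0 < R →
      ∫⁻ x : EuclideanSpace ℝ (Fin d),
        (Set.Iic R).indicator (fun y => ENNReal.ofReal (y ^ p)) ‖x‖ ≤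
      ENNReal.ofReal (A * R ^ (p + d)) := by
  refine ⟨d * volume.real (Metric.ball (0 : EuclideanSpace ℝ (Fin d)) 1) / (p + d) + 1,
    ?_, fun R hR => ?_⟩
  · have : 0 < p + d := by linarith
    positivity
  have h0 : 0 < p + d := by linarith
  have hI : IntegrableOn (fun y : ℝ => y ^ (p + d - 1)) (Set.Ioc 0 R) := by
    rw [← intervalIntegrable_iff_integrableOn_Ioc_of_le hR.le]
    exact intervalIntegral.intervalIntegrable_rpow' (by linarith)
  have hset : Set.Iic R ∩ Set.Ioi 0 = Set.Ioc 0 R := by ext; simp [and_comm]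
  rw [lintegral_indicator_norm_rpow hd measurableSet_Iic (by rwa [hset]), hset,
    ← intervalIntegral.integral_of_le hR.le, integral_rpow (Or.inl (by linarith)),
    Real.zero_rpow (by linarith)]
  refine ENNReal.ofReal_le_ofReal ?_
  have : 0 ≤ R ^ (p + d) := by positivity
  rw [add_mul, show p + d - 1 + 1 = p + d by ring, sub_zero, one_mul, div_mul_eq_mul_div,
    mul_div_assoc]
  linarith

theorem exists_lintegral_norm_rpow_Ioi_le (hd : 1 ≤ d) {p : ℝ} (hp : p < -(d : ℝ)) :
    ∃ A : ℝ, 0 < A ∧ ∀ R : ℝ, 0 < R →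
      ∫⁻ x : EuclideanSpace ℝ (Fin d),
        (Set.Ioi R).indicator (fun y => ENNReal.ofReal (y ^ p)) ‖x‖ ≤
      ENNReal.ofReal (A * R ^ (p + d)) := by
  have h0 : 0 < -(p + d) := by linarith
  refine ⟨d * volume.real (Metric.ball (0 : EuclideanSpace ℝ (Fin d)) 1) / (-(p + d)) + 1,
    by positivity, fun R hR => ?_⟩
  have hI : IntegrableOn (fun y : ℝ => y ^ (p + d - 1)) (Set.Ioi R) :=
    integrableOn_Ioi_rpow_of_lt (by linarith) hR
  have hset : Set.Ioi R ∩ Set.Ioi 0 = Set.Ioi R := by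
    rw [Set.Ioi_inter_Ioi, sup_eq_left.mpr hR.le]
  rw [lintegral_indicator_norm_rpow hd measurableSet_Ioi (by rwa [hset]), hset,
    integral_Ioi_rpow_of_lt (by linarith) hR]
  refine ENNReal.ofReal_le_ofReal ?_
  have : 0 ≤ R ^ (p + d) := by positivity
  rw [add_mul, show p + d - 1 + 1 = p + d by ring, one_mul, neg_div, ← div_neg,
    div_mul_eq_mul_div, mul_div_assoc]
  linarith

end Powers

/-! ### Bounds for Gamma and sine on vertical lines -/

section Gamma

open Complex

/-- The modulus of `x^{u-1} (1-x)^{v-1}` depends only on the real parts of `u` and `v`. -/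
theorem norm_betaIntegral_le (u v : ℂ) :
    ‖betaIntegral u v‖ ≤ ‖betaIntegral (u.re : ℂ) (v.re : ℂ)‖ := by
  have hn (a b : ℂ) {x : ℝ} (hx : x ∈ Set.Ioo (0 : ℝ) 1) :
      ‖(x : ℂ) ^ (a - 1) * (1 - (x : ℂ)) ^ (b - 1)‖ = x ^ (a.re - 1) * (1 - x) ^ (b.re - 1) := by
    have h1 : (1 - (x : ℂ)) = ((1 - x : ℝ) : ℂ) := by push_cast; rfl
    rw [norm_mul, norm_cpow_eq_rpow_re_of_pos hx.1, h1,
      norm_cpow_eq_rpow_re_of_pos (by linarith [hx.2])]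
    simp
  have hr : betaIntegral (u.re : ℂ) (v.re : ℂ) =
      ((∫ x in (0 : ℝ)..1, x ^ (u.re - 1) * (1 - x) ^ (v.re - 1) : ℝ) : ℂ) := by
    rw [betaIntegral, ← intervalIntegral.integral_ofReal]
    refine intervalIntegral.integral_congr fun x hx => ?_
    rw [Set.uIcc_of_le zero_le_one] at hx
    have h1 : (1 - (x : ℂ)) = ((1 - x : ℝ) : ℂ) := by push_cast; rfl
    simp only [h1, ofReal_mul]
    rw [ofReal_cpow hx.1, ofReal_cpow (by linarith [hx.2])]
    push_cast; rfl
  have h0 : 0 ≤ ∫ x in (0 : ℝ)..1, x ^ (u.re - 1) * (1 - x) ^ (v.re - 1) := by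
    refine intervalIntegral.integral_nonneg zero_le_one fun x hx => ?_
    have : 0 ≤ 1 - x := by linarith [hx.2]
    have := hx.1
    positivity
  rw [hr, norm_real, Real.norm_of_nonneg h0, betaIntegral]
  refine (intervalIntegral.norm_integral_le_integral_norm zero_le_one).trans_eq ?_
  rw [intervalIntegral.integral_of_le zero_le_one, intervalIntegral.integral_of_le zero_le_one,
    integral_Ioc_eq_integral_Ioo, integral_Ioc_eq_integral_Ioo]
  exact setIntegral_congr_fun measurableSet_Ioo fun x hx => hn u v hx

/-- On vertical lines the quotient `|Γ(a + iv)| / |Γ(b + iv)|`, `a < b`, is largest at `v = 0`. -/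
theorem norm_Gamma_mul_le {a b : ℝ} (ha : 0 < a) (hab : a < b) (v : ℝ) :
    ‖Gamma (a + v * I)‖ * Real.Gamma b ≤ Real.Gamma a * ‖Gamma (b + v * I)‖ := by
  have hc : 0 < b - a := sub_pos.2 hab
  -- Since `Γ(a + iv) Γ(b - a) = Γ(b + iv) B(a + iv, b - a)`, the quotient of Gammas is a Beta
  -- integral up to a constant, and the Beta integral is largest at `v = 0`.
  have h := norm_betaIntegral_le (a + v * I) ((b - a : ℝ) : ℂ)
  have e1 := Gamma_mul_Gamma_eq_betaIntegral (s := a + v * I) (t := ((b - a : ℝ) : ℂ))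
    (by simpa) (by simpa)
  have e2 := Gamma_mul_Gamma_eq_betaIntegral (s := (a : ℂ)) (t := ((b - a : ℝ) : ℂ))
    (by simpa) (by simpa)
  have s1 : (a + v * I + ((b - a : ℝ) : ℂ)) = b + v * I := by push_cast; ring
  have s2 : ((a : ℂ) + ((b - a : ℝ) : ℂ)) = (b : ℂ) := by push_cast; ring
  rw [s1] at e1
  rw [s2] at e2
  have e1' := congrArg norm e1
  have e2' := congrArg norm e2
  simp only [norm_mul, Gamma_ofReal, norm_real] at e1' e2'
  have ga := Real.Gamma_pos_of_pos ha
  have gb := Real.Gamma_pos_of_pos (ha.trans hab)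
  have gc := Real.Gamma_pos_of_pos hc
  rw [Real.norm_of_nonneg ga.le, Real.norm_of_nonneg gc.le, Real.norm_of_nonneg gb.le] at e2'
  rw [Real.norm_of_nonneg gc.le] at e1'
  simp only [add_re, ofReal_re, mul_re, I_re, mul_zero, ofReal_im, I_im, mul_one, sub_self,
    add_zero] at h
  have h3 : ‖Gamma (a + v * I)‖ * Real.Gamma (b - a) * Real.Gamma b ≤
      Real.Gamma a * ‖Gamma (b + v * I)‖ * Real.Gamma (b - a) := by
    rw [e1']
    calc _ ≤ ‖Gamma (b + v * I)‖ * ‖betaIntegral (a : ℂ) ((b - a : ℝ) : ℂ)‖ * Real.Gamma b := by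
            gcongr
      _ = ‖Gamma (b + v * I)‖ * (Real.Gamma b * ‖betaIntegral (a : ℂ) ((b - a : ℝ) : ℂ)‖) := by
            ring
      _ = _ := by rw [← e2']; ring
  nlinarith

theorem norm_Gamma_add_nat_le {w : ℂ} (hw : 0 < w.re) (n : ℕ) :
    ‖Gamma (w + n)‖ ≤ (‖w‖ + n) ^ n * ‖Gamma w‖ := by
  induction n with
  | zero => simp
  | succ n ih =>
    have hne : w + n ≠ 0 := by
      intro h
      have := congrArg re h
      simp at this
      have : (0 : ℝ) ≤ n := Nat.cast_nonneg n
      linarith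
    have h1 : w + ((n + 1 : ℕ) : ℂ) = (w + n) + 1 := by push_cast; ring
    have h2 : ‖w + n‖ ≤ ‖w‖ + n := by simpa using norm_add_le w (n : ℂ)
    rw [h1, Gamma_add_one _ hne, norm_mul]
    push_cast
    have h3 : ‖w‖ + n ≤ ‖w‖ + (n + 1) := by linarith
    calc ‖w + n‖ * ‖Gamma (w + n)‖ ≤ (‖w‖ + n) * ((‖w‖ + n) ^ n * ‖Gamma w‖) := by gcongr
      _ = (‖w‖ + n) ^ (n + 1) * ‖Gamma w‖ := by ring
      _ ≤ _ := by gcongr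

theorem norm_Gamma_le {w : ℂ} (hw : 0 < w.re) : ‖Gamma w‖ ≤ Real.Gamma w.re := by
  rw [Gamma_eq_integral hw, Real.Gamma_eq_integral hw, GammaIntegral]
  refine (norm_integral_le_integral_norm _).trans_eq ?_
  refine setIntegral_congr_fun measurableSet_Ioi fun x hx => ?_
  simp only [norm_mul, norm_real, norm_cpow_eq_rpow_re_of_pos hx]
  rw [Real.norm_of_nonneg (Real.exp_pos _).le]
  simp

theorem norm_sin_le (w : ℂ) : ‖sin w‖ ≤ Real.exp |w.im| := by
  rw [sin, norm_div, norm_mul, norm_I, mul_one]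
  have h := norm_sub_le (exp (-w * I)) (exp (w * I))
  simp only [norm_exp, neg_mul, neg_re, mul_re, I_re, mul_zero, I_im, mul_one, zero_sub,
    neg_neg] at h
  have h1 : Real.exp w.im ≤ Real.exp |w.im| := Real.exp_le_exp.2 (le_abs_self _)
  have h2 : Real.exp (-w.im) ≤ Real.exp |w.im| := Real.exp_le_exp.2 (neg_le_abs _)
  simp only [neg_mul, RCLike.norm_ofNat]
  linarith

/-- The two exponentials in `sin w` have moduli `e^{±Im w}`; for `|Im w| ≥ 1` the smaller is at most
half the larger, so they cannot cancel. -/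
theorem exp_le_norm_sin {w : ℂ} (hw : 1 ≤ |w.im|) : Real.exp |w.im| / 4 ≤ ‖sin w‖ := by
  rw [sin, norm_div, norm_mul, norm_I, mul_one]
  have h1 := norm_sub_norm_le (exp (-w * I)) (exp (w * I))
  have h2 := norm_sub_norm_le (exp (w * I)) (exp (-w * I))
  rw [norm_sub_rev] at h2
  simp only [norm_exp, neg_mul, neg_re, mul_re, I_re, mul_zero, I_im, mul_one, zero_sub,
    neg_neg] at h1 h2
  have h3 : Real.exp (-|w.im|) ≤ Real.exp |w.im| / 2 := by
    have e : Real.exp |w.im| = Real.exp (-|w.im|) * Real.exp (2 * |w.im|) := by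
      rw [← Real.exp_add]; ring_nf
    have := Real.add_one_le_exp (2 * |w.im|)
    have := Real.exp_pos (-|w.im|)
    nlinarith
  simp only [neg_mul, RCLike.norm_ofNat]
  rcases abs_cases w.im with ⟨h, -⟩ | ⟨h, -⟩
  · rw [h] at h3 ⊢; linarith
  · rw [h] at h3 ⊢; rw [neg_neg] at h3; linarith

theorem exists_pow_le_exp {A B δ : ℝ} (hA : 0 ≤ A) (hB : 0 < B) (hδ : 0 < δ) (n : ℕ) :
    ∃ M : ℝ, 0 < M ∧ ∀ x : ℝ, 0 ≤ x → (A + B * x) ^ n ≤ M * Real.exp (δ * x) := by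
  -- The constant comes from `u^n / n! ≤ e^u` at `u = (δ/B)(A + Bx)`.
  refine ⟨n.factorial / (δ / B) ^ n * Real.exp (δ / B * A), by positivity, fun x hx => ?_⟩
  have h := Real.pow_div_factorial_le_exp (x := δ / B * (A + B * x)) (by positivity) n
  rw [div_le_iff₀ (by positivity), mul_pow] at h
  have e : δ / B * (A + B * x) = δ / B * A + δ * x := by field_simp
  rw [e, Real.exp_add] at h
  rw [div_mul_eq_mul_div, div_mul_eq_mul_div, le_div_iff₀ (by positivity)]
  linarith

end Gamma

/-! ### Shifting vertical contours -/

section Contour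

open Complex Filter Topology

/-- Exponential decay in a closed vertical strip. -/
def StripDecay (f : ℂ → ℂ) (a b : ℝ) : Prop :=
  ∃ C ε : ℝ, 0 < ε ∧ ∀ σ ∈ Set.Icc a b, ∀ y : ℝ, ‖f (σ + y * I)‖ ≤ C * Real.exp (-ε * |y|)

variable {f : ℂ → ℂ} {a b : ℝ}

/-- The part of the strip with `|y| ≤ 1` is compact, so continuity bounds `f` there. Hence the decay
estimates need only be proved away from the real axis, where the poles lie. -/
theorem stripDecay_of_large (hf : ContinuousOn f (re ⁻¹' Set.Icc a b)) {C ε : ℝ} (hε : 0 < ε)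
    (h : ∀ σ ∈ Set.Icc a b, ∀ y : ℝ, 1 ≤ |y| → ‖f (σ + y * I)‖ ≤ C * Real.exp (-ε * |y|)) :
    StripDecay f a b := by
  have hK : IsCompact (Set.Icc a b ×ˢ Set.Icc (-1 : ℝ) 1) := isCompact_Icc.prod isCompact_Icc
  have hc : ContinuousOn (fun p : ℝ × ℝ => f (p.1 + p.2 * I)) (Set.Icc a b ×ˢ Set.Icc (-1) 1) :=
    hf.comp (by fun_prop) fun p hp => by simpa using hp.1
  obtain ⟨M, hM⟩ := hK.exists_bound_of_continuousOn hc
  refine ⟨max C (M * Real.exp ε), ε, hε, fun σ hσ y => ?_⟩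
  by_cases hy : 1 ≤ |y|
  · exact (h σ hσ y hy).trans (by gcongr; exact le_max_left _ _)
  · have hy' := not_le.1 hy
    have h1 := hM (σ, y) ⟨hσ, abs_le.1 hy'.le⟩
    have hM0 : 0 ≤ M := (norm_nonneg _).trans h1
    calc ‖f (σ + y * I)‖ ≤ M * Real.exp (ε + -ε * |y|) := by
          refine h1.trans (le_mul_of_one_le_right hM0 (Real.one_le_exp ?_))
          nlinarith
      _ = M * Real.exp ε * Real.exp (-ε * |y|) := by rw [Real.exp_add]; ring
      _ ≤ _ := by gcongr; exact le_max_right _ _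

theorem StripDecay.mul_bounded {g : ℂ → ℂ} {M : ℝ} (h : StripDecay f a b)
    (hg : ∀ s ∈ re ⁻¹' Set.Icc a b, ‖g s‖ ≤ M) : StripDecay (fun s => g s * f s) a b := by
  obtain ⟨C, ε, hε, h⟩ := h
  refine ⟨M * C, ε, hε, fun σ hσ y => ?_⟩
  have h1 := h σ hσ y
  have h2 := hg (σ + y * I) (by simpa using hσ)
  rw [norm_mul, mul_assoc]
  exact mul_le_mul h2 h1 (norm_nonneg _) ((norm_nonneg _).trans h2)

theorem integrable_exp_neg_mul_abs {ε : ℝ} (hε : 0 < ε) :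
    Integrable fun y : ℝ => Real.exp (-ε * |y|) := by
  have h := (integrable_fun_norm_addHaar (volume : Measure ℝ)
    (f := fun y => Real.exp (-ε * y))).2 (by simpa using exp_neg_integrableOn_Ioi 0 hε)
  simpa using h

theorem StripDecay.integrable (hf : ContinuousOn f (re ⁻¹' Set.Icc a b))
    (h : StripDecay f a b) {σ : ℝ} (hσ : σ ∈ Set.Icc a b) :
    Integrable fun y : ℝ => f (σ + y * I) := by
  obtain ⟨C, ε, hε, h⟩ := h
  refine Integrable.mono' ((integrable_exp_neg_mul_abs hε).const_mul C) ?_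
    (Eventually.of_forall fun y => h σ hσ y)
  refine Continuous.aestronglyMeasurable ?_
  exact hf.comp_continuous (by fun_prop) fun y => by simpa using hσ

/-- Shift of a vertical contour. -/
theorem integral_vertical_eq (hab : a ≤ b) (hf : DifferentiableOn ℂ f (re ⁻¹' Set.Icc a b))
    (h : StripDecay f a b) : ∫ y : ℝ, f (a + y * I) = ∫ y : ℝ, f (b + y * I) := by
  have ia := h.integrable hf.continuousOn (Set.left_mem_Icc.2 hab)
  have ib := h.integrable hf.continuousOn (Set.right_mem_Icc.2 hab)
  obtain ⟨C, ε, hε, h⟩ := h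
  have ta := intervalIntegral_tendsto_integral ia tendsto_neg_atTop_atBot tendsto_id
  have tb := intervalIntegral_tendsto_integral ib tendsto_neg_atTop_atBot tendsto_id
  have hexp : Tendsto (fun T : ℝ => C * Real.exp (-ε * T) * |b - a|) atTop (𝓝 0) := by
    have : Tendsto (fun T : ℝ => Real.exp (-ε * T)) atTop (𝓝 0) :=
      Real.tendsto_exp_atBot.comp (tendsto_id.const_mul_atTop_of_neg (neg_lt_zero.2 hε))
    simpa using (this.const_mul C).mul_const |b - a|
  -- The horizontal sides have fixed length `b - a`, so their contribution vanishes with the decay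
  -- of `f`.
  have hor (τ : ℝ → ℝ) (hτ : ∀ T, |τ T| = |T|) :
      Tendsto (fun T : ℝ => ∫ x : ℝ in a..b, f (x + τ T * I)) atTop (𝓝 0) := by
    refine squeeze_zero_norm' ?_ hexp
    filter_upwards [eventually_ge_atTop 0] with T hT
    refine intervalIntegral.norm_integral_le_of_norm_le_const fun x hx => ?_
    rw [Set.uIoc_of_le hab] at hx
    have := h x ⟨hx.1.le, hx.2⟩ (τ T)
    rwa [hτ, abs_of_nonneg hT] at this
  have t1 := hor (fun T => -T) (by simp)
  have t2 := hor (fun T => T) (by simp)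
  have t := ((t1.sub t2).add (tb.const_smul I)).sub (ta.const_smul I)
  have hz : ∀ T : ℝ, (∫ x : ℝ in a..b, f (x + ((-T : ℝ) : ℂ) * I)) -
      (∫ x : ℝ in a..b, f (x + (T : ℂ) * I)) + I • (∫ y : ℝ in (-T)..(id T), f (b + y * I)) -
      I • (∫ y : ℝ in (-T)..(id T), f (a + y * I)) = 0 := by
    intro T
    have := integral_boundary_rect_eq_zero_of_differentiableOn f (a + ((-T : ℝ) : ℂ) * I)
      (b + (T : ℂ) * I) (hf.mono fun s hs => by
        have := hs.1
        simpa [Set.uIcc_of_le hab] using this)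
    simpa using this
  have t' := tendsto_nhds_unique (t.congr hz) tendsto_const_nhds
  simp only [sub_self, zero_add, smul_eq_mul] at t'
  have := mul_left_cancel₀ I_ne_zero (sub_eq_zero.1 t')
  exact this.symm

end Contour

/-! ### Decay and holomorphy of the symbol of `Z` -/

section Symbol

open Complex Filter Topology

variable {α β : ℝ} {d : ℕ}

theorem foxSymbol_Z (α β : ℝ) (d : ℕ) (s : ℂ) :
    foxSymbol 1 2 (paramA β d) (paramZ α) s =
      Gamma s * (Gamma (d / 2 - β / 2 * s) * Gamma (1 - s)) *
        ((Gamma (β / 2 * s))⁻¹ * (Gamma (1 - α * s))⁻¹) := by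
  simp [foxSymbol, paramA, paramZ, div_eq_mul_inv]
  left
  ring

/-- The exponential rates add up to `-π + πα`; half of `π(1 - α)` absorbs the polynomial factor and
half remains as `ε`. With `|y| ≥ 1` the poles of `Γ(1 - s)` play no role, so the strip may extend
beyond `Re s = 1`. -/
theorem exists_norm_foxSymbol_Z_le (hα0 : 0 < α) (hα1 : α < 1) (hβ0 : 0 < β) {a b : ℝ}
    (ha : 0 < a) (hb : b < d / β) :
    ∃ C ε : ℝ, 0 < ε ∧ ∀ σ ∈ Set.Icc a b, ∀ y : ℝ, 1 ≤ |y| →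
      ‖foxSymbol 1 2 (paramA β d) (paramZ α) (σ + y * I)‖ ≤ C * Real.exp (-ε * |y|) := by
  have hpos : ∀ σ ∈ Set.Icc a b, 0 < σ ∧ 0 < d / 2 - β / 2 * σ := fun σ hσ => by
    have h := hσ.2.trans_lt hb
    rw [lt_div_iff₀ hβ0] at h
    exact ⟨ha.trans_le hσ.1, by linarith⟩
  -- the part of the bound that depends on the real part only
  obtain ⟨M, hM⟩ := isCompact_Icc.exists_bound_of_continuousOn (s := Set.Icc a b)
    (f := fun σ : ℝ => Real.Gamma (α * σ) *
      (Real.Gamma (d / 2 - β / 2 * σ) / Real.Gamma (β / 2 * σ + d))) (by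
    have hG {g : ℝ → ℝ} (hg : Continuous g) (hp : ∀ σ ∈ Set.Icc a b, 0 < g σ) :
        ContinuousOn (fun σ => Real.Gamma (g σ)) (Set.Icc a b) := fun σ hσ =>
      ((Real.differentiableAt_Gamma fun m =>
        (by linarith [hp σ hσ, (Nat.cast_nonneg m : (0 : ℝ) ≤ m)] : -(m : ℝ) < g σ).ne').continuousAt.comp
        hg.continuousAt).continuousWithinAt
    refine (hG (by fun_prop) fun σ hσ => ?_).mul ((hG (by fun_prop) fun σ hσ => ?_).div
      (hG (by fun_prop) fun σ hσ => ?_) fun σ hσ => ?_)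
    · exact mul_pos hα0 (hpos σ hσ).1
    · exact (hpos σ hσ).2
    · have := (hpos σ hσ).1; positivity
    · have := (hpos σ hσ).1; exact (Real.Gamma_pos_of_pos (by positivity)).ne')
  have hδ : 0 < Real.pi * (1 - α) / 2 := by have := Real.pi_pos; nlinarith
  obtain ⟨N, hN0, hN⟩ := exists_pow_le_exp (A := β / 2 * |b| + d) (B := β / 2)
    (δ := Real.pi * (1 - α) / 2) (by positivity) (by positivity) hδ d
  refine ⟨4 * M * N, Real.pi * (1 - α) / 2, hδ, fun σ hσ y hy => ?_⟩
  obtain ⟨hσ0, hσ1⟩ := hpos σ hσ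
  set s : ℂ := σ + y * I with hs
  have sre : s.re = σ := by simp [hs]
  have sim : s.im = y := by simp [hs]
  have hpi := Real.pi_pos
  -- `Γ(s) Γ(1 - s)`
  have h1 : ‖Gamma s * Gamma (1 - s)‖ ≤ Real.pi * 4 * Real.exp (-(Real.pi * |y|)) := by
    have him : |(Real.pi * s).im| = Real.pi * |y| := by
      simp [sim, abs_mul, abs_of_pos hpi]
    have := exp_le_norm_sin (w := Real.pi * s) (by rw [him]; nlinarith [Real.pi_gt_three])
    rw [him] at this
    rw [Gamma_mul_Gamma_one_sub, norm_div, norm_real, Real.norm_of_nonneg hpi.le, Real.exp_neg]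
    rw [div_le_iff₀ ((by positivity : (0 : ℝ) < _).trans_le this)]
    have he := Real.exp_pos (Real.pi * |y|)
    calc Real.pi = Real.pi * 4 * (Real.exp (Real.pi * |y|))⁻¹ * (Real.exp (Real.pi * |y|) / 4) := by
          field_simp
      _ ≤ _ := by gcongr
  -- `1 / Γ(1 - α s)`
  have h2 : ‖(Gamma (1 - α * s))⁻¹‖ ≤
      Real.Gamma (α * σ) * Real.exp (Real.pi * α * |y|) / Real.pi := by
    have hrefl := Gamma_mul_Gamma_one_sub (α * s)
    have him : (Real.pi * (α * s)).im = Real.pi * α * y := by simp [sim]; ring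
    have hsin : sin (Real.pi * (α * s)) ≠ 0 := by
      intro h0
      rw [sin_eq_zero_iff] at h0
      obtain ⟨k, hk⟩ := h0
      have := congrArg im hk
      rw [him] at this
      simp [hα0.ne', hpi.ne'] at this
      rw [this] at hy
      norm_num at hy
    have hne : Gamma (1 - α * s) ≠ 0 := by
      intro h0
      rw [h0, mul_zero, eq_comm, div_eq_zero_iff] at hrefl
      rcases hrefl with h | h
      · exact hpi.ne' (by exact_mod_cast h)
      · exact hsin h
    have e : (Gamma (1 - α * s))⁻¹ = Gamma (α * s) * sin (Real.pi * (α * s)) / Real.pi := by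
      have : (Real.pi : ℂ) ≠ 0 := by exact_mod_cast hpi.ne'
      rw [eq_div_iff hsin] at hrefl
      rw [eq_div_iff this, inv_mul_eq_iff_eq_mul₀ hne]
      linear_combination -hrefl
    have g1 := norm_Gamma_le (w := α * s) (by simp [sre]; positivity)
    have g2 := norm_sin_le (Real.pi * (α * s))
    rw [him, abs_mul, abs_of_pos (by positivity : 0 < Real.pi * α)] at g2
    rw [e, norm_div, norm_mul, norm_real, Real.norm_of_nonneg hpi.le]
    have : (α * s).re = α * σ := by simp [sre]
    rw [this] at g1
    have := (norm_nonneg _).trans g1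
    gcongr
  -- `Γ(d / 2 - β s / 2) / Γ(β s / 2)`
  have h3 : ‖Gamma (d / 2 - β / 2 * s)‖ * ‖(Gamma (β / 2 * s))⁻¹‖ ≤
      Real.Gamma (d / 2 - β / 2 * σ) / Real.Gamma (β / 2 * σ + d) *
        (β / 2 * |b| + d + β / 2 * |y|) ^ d := by
    -- Conjugation preserves the modulus of Gamma and gives both arguments the same imaginary part,
    -- as `norm_Gamma_mul_le` requires.
    have e1 : (d / 2 - β / 2 * s : ℂ) =
        (starRingEnd ℂ) (((d / 2 - β / 2 * σ : ℝ) : ℂ) + ((β / 2 * y : ℝ) : ℂ) * I) := by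
      have h2 : (starRingEnd ℂ) 2 = 2 := map_ofNat _ 2
      simp [hs, h2]; ring
    have e2 : (((β / 2 * σ + d : ℝ) : ℂ) + ((β / 2 * y : ℝ) : ℂ) * I) = β / 2 * s + d := by
      simp [hs]; ring
    have hbs : 0 < (β / 2 * s : ℂ).re := by
      have : (β / 2 * s : ℂ).re = β / 2 * σ := by simp [hs]
      rw [this]; positivity
    -- The comparison needs the larger real part in the denominator, so `βs/2` is raised by `d`,
    -- which suffices because `d/2 - βσ/2 < βσ/2 + d`. Undoing the shift costs a polynomial of
    -- degree `d`.
    have g1 := norm_Gamma_mul_le hσ1 (b := β / 2 * σ + d) (by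
      have := mul_pos hβ0 hσ0
      have : (0 : ℝ) ≤ d := Nat.cast_nonneg d
      linarith) (β / 2 * y)
    rw [e2] at g1
    have g2 := norm_Gamma_add_nat_le hbs d
    have hG : 0 < Real.Gamma (β / 2 * σ + d) := Real.Gamma_pos_of_pos (by positivity)
    have hG' : 0 < Real.Gamma (d / 2 - β / 2 * σ) := Real.Gamma_pos_of_pos hσ1
    have hGb : 0 < ‖Gamma (β / 2 * s)‖ := norm_pos_iff.2 (Gamma_ne_zero_of_re_pos hbs)
    have hns : ‖(β / 2 * s : ℂ)‖ ≤ β / 2 * |b| + β / 2 * |y| := by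
      have : ‖s‖ ≤ |b| + |y| := by
        refine (norm_add_le _ _).trans ?_
        simp only [norm_real, norm_mul, norm_I, mul_one, Real.norm_eq_abs]
        rw [abs_of_pos hσ0]
        linarith [hσ.2.trans (le_abs_self b)]
      have hb2 : ‖(β / 2 : ℂ)‖ = β / 2 := by
        simp [abs_of_pos hβ0]
      rw [norm_mul, hb2]
      nlinarith
    rw [e1, Gamma_conj, norm_conj, norm_inv, ← div_eq_mul_inv, div_le_iff₀ hGb]
    refine ((le_div_iff₀ hG).2 g1).trans ?_
    rw [mul_div_right_comm, mul_assoc _ (_ ^ d)]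
    refine mul_le_mul_of_nonneg_left (g2.trans ?_) (by positivity)
    gcongr ?_ ^ d * _
    linarith
  have hMσ := (le_abs_self _).trans (hM σ hσ)
  have hg1 : 0 < Real.Gamma (α * σ) := Real.Gamma_pos_of_pos (by positivity)
  have hg2 : 0 < Real.Gamma (d / 2 - β / 2 * σ) := Real.Gamma_pos_of_pos hσ1
  have hg3 : 0 < Real.Gamma (β / 2 * σ + d) := Real.Gamma_pos_of_pos (by positivity)
  rw [foxSymbol_Z]
  calc _ = ‖Gamma s * Gamma (1 - s)‖ * ‖(Gamma (1 - α * s))⁻¹‖ *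
        (‖Gamma (d / 2 - β / 2 * s)‖ * ‖(Gamma (β / 2 * s))⁻¹‖) := by
        simp only [norm_mul]; ring
    _ ≤ (Real.pi * 4 * Real.exp (-(Real.pi * |y|))) *
        (Real.Gamma (α * σ) * Real.exp (Real.pi * α * |y|) / Real.pi) *
        (Real.Gamma (d / 2 - β / 2 * σ) / Real.Gamma (β / 2 * σ + d) *
        (N * Real.exp (Real.pi * (1 - α) / 2 * |y|))) := by
        refine mul_le_mul (mul_le_mul h1 h2 (norm_nonneg _) (by positivity)) ?_ (by positivity)
          (by positivity)
        exact h3.trans (mul_le_mul_of_nonneg_left (hN |y| (abs_nonneg y)) (by positivity))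
    _ = 4 * (Real.Gamma (α * σ) *
        (Real.Gamma (d / 2 - β / 2 * σ) / Real.Gamma (β / 2 * σ + d))) * N *
        (Real.exp (-(Real.pi * |y|)) * Real.exp (Real.pi * α * |y|) *
          Real.exp (Real.pi * (1 - α) / 2 * |y|)) := by
        field_simp
    _ = 4 * (Real.Gamma (α * σ) *
        (Real.Gamma (d / 2 - β / 2 * σ) / Real.Gamma (β / 2 * σ + d))) * N *
        Real.exp (-(Real.pi * (1 - α) / 2) * |y|) := by
        rw [← Real.exp_add, ← Real.exp_add]; ring_nf
    _ ≤ _ := by gcongr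

theorem differentiableOn_Gamma_comp {g : ℂ → ℂ} (hg : Differentiable ℂ g) {S : Set ℂ}
    (hS : ∀ s ∈ S, ∀ m : ℕ, (g s).re ≠ -m) : DifferentiableOn ℂ (fun s => Gamma (g s)) S :=
  fun s hs => ((differentiableAt_Gamma _ fun m h => hS s hs m (by simp [h])).comp s
    (hg s)).differentiableWithinAt

theorem ne_neg_natCast_of_pos {x : ℝ} (hx : 0 < x) (m : ℕ) : x ≠ -m := by
  have : (0 : ℝ) ≤ m := Nat.cast_nonneg m
  exact ne_of_gt (by linarith)

theorem differentiable_inv_Gamma_comp {g : ℂ → ℂ} (hg : Differentiable ℂ g) :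
    Differentiable ℂ (fun s => (Gamma (g s))⁻¹) :=
  differentiable_one_div_Gamma.comp hg

theorem half_sub_re_pos (hβ0 : 0 < β) {b : ℝ} (hb : b < d / β) {s : ℂ} (hs : s.re ≤ b) :
    0 < (d / 2 - β / 2 * s : ℂ).re := by
  have h := hs.trans_lt hb
  rw [lt_div_iff₀ hβ0] at h
  have : (d / 2 - β / 2 * s : ℂ).re = d / 2 - β / 2 * s.re := by simp
  rw [this]
  linarith

/-- Reciprocals of Gamma are entire. The condition `hb1` excludes only the poles of `Γ(1 - s)`,
instead of asking `b < 1`, so that lines to the right of `s = 1` are covered. -/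
theorem differentiableOn_foxSymbol_Z (hβ0 : 0 < β) {a b : ℝ} (ha : 0 < a) (hb : b < d / β)
    (hb1 : ∀ σ ∈ Set.Icc a b, ∀ m : ℕ, 1 - σ ≠ -m) :
    DifferentiableOn ℂ (foxSymbol 1 2 (paramA β d) (paramZ α)) (re ⁻¹' Set.Icc a b) := by
  rw [show foxSymbol 1 2 (paramA β d) (paramZ α) = _ from funext (foxSymbol_Z α β d)]
  exact ((differentiableOn_Gamma_comp differentiable_id fun s hs =>
      ne_neg_natCast_of_pos (ha.trans_le hs.1)).mul
    ((differentiableOn_Gamma_comp (by fun_prop) fun s hs =>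
      ne_neg_natCast_of_pos (half_sub_re_pos hβ0 hb hs.2)).mul
      (differentiableOn_Gamma_comp (by fun_prop) fun s hs m => by
        simpa using hb1 s.re hs m))).mul
    ((differentiable_inv_Gamma_comp (by fun_prop)).mul
      (differentiable_inv_Gamma_comp (by fun_prop))).differentiableOn

theorem one_sub_ne_neg_natCast {a b : ℝ} (hb : b < 1) :
    ∀ σ ∈ Set.Icc a b, ∀ m : ℕ, 1 - σ ≠ -m := fun _ hσ =>
  ne_neg_natCast_of_pos (by linarith [hσ.2])

theorem stripDecay_foxSymbol_Z (hα0 : 0 < α) (hα1 : α < 1) (hβ0 : 0 < β) {a b : ℝ}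
    (ha : 0 < a) (hb : b < d / β) (hb1 : ∀ σ ∈ Set.Icc a b, ∀ m : ℕ, 1 - σ ≠ -m) :
    StripDecay (foxSymbol 1 2 (paramA β d) (paramZ α)) a b := by
  obtain ⟨C, ε, hε, h⟩ := exists_norm_foxSymbol_Z_le hα0 hα1 hβ0 ha hb
  exact stripDecay_of_large (differentiableOn_foxSymbol_Z hβ0 ha hb hb1).continuousOn hε h

theorem integrable_foxSymbol_Z (hα0 : 0 < α) (hα1 : α < 1) (hβ0 : 0 < β) {c : ℝ}
    (hc : 0 < c) (hc' : c < d / β) (hc1 : ∀ m : ℕ, 1 - c ≠ -m) :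
    Integrable fun y : ℝ => foxSymbol 1 2 (paramA β d) (paramZ α) (c + y * I) := by
  have h : ∀ σ ∈ Set.Icc c c, ∀ m : ℕ, 1 - σ ≠ -m := fun σ hσ => by
    rw [Set.Icc_self, Set.mem_singleton_iff] at hσ
    rwa [hσ]
  exact (stripDecay_foxSymbol_Z hα0 hα1 hβ0 hc hc' h).integrable
    (differentiableOn_foxSymbol_Z hβ0 hc hc' h).continuousOn (by simp)

end Symbol

/-! ### Power bounds for the H-function -/

section FoxH

open Complex Filter Topology

variable {α β : ℝ} {d : ℕ}

theorem norm_cpow_neg_vertical {z : ℝ} (hz : 0 < z) (c y : ℝ) :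
    ‖(z : ℂ) ^ (-((c : ℂ) + y * I))‖ = z ^ (-c) := by
  rw [norm_cpow_eq_rpow_re_of_pos hz]
  simp

theorem norm_mellinInv_le (f : ℂ → ℂ) (c : ℝ) {z : ℝ} (hz : 0 < z) :
    ‖mellinInv c f z‖ ≤ (1 / (2 * Real.pi) * ∫ y : ℝ, ‖f (c + y * I)‖) * z ^ (-c) := by
  have h : ‖∫ y : ℝ, (z : ℂ) ^ (-((c : ℂ) + y * I)) • f (c + y * I)‖ ≤
      z ^ (-c) * ∫ y : ℝ, ‖f (c + y * I)‖ := by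
    refine (norm_integral_le_integral_norm _).trans_eq ?_
    simp_rw [norm_smul, norm_cpow_neg_vertical hz]
    exact integral_const_mul _ _
  have hp : (0 : ℝ) ≤ 1 / (2 * Real.pi) := by have := Real.pi_pos; positivity
  rw [mellinInv, norm_smul, Real.norm_of_nonneg hp, mul_assoc]
  refine mul_le_mul_of_nonneg_left (h.trans_eq (mul_comm _ _)) hp

theorem exists_norm_cpow_le {z : ℝ} (hz : 0 < z) (w : ℂ) (a b : ℝ) :
    ∃ M : ℝ, ∀ s ∈ re ⁻¹' Set.Icc a b, ‖(z : ℂ) ^ (w - s)‖ ≤ M := by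
  obtain ⟨M, hM⟩ := isCompact_Icc.exists_bound_of_continuousOn (s := Set.Icc a b)
    (f := fun σ : ℝ => z ^ (w.re - σ)) (by
      have := hz.ne'
      fun_prop (disch := assumption))
  refine ⟨M, fun s hs => ?_⟩
  rw [norm_cpow_eq_rpow_re_of_pos hz]
  exact (le_abs_self _).trans (hM s.re hs)

theorem mellinInv_eq_of_stripDecay {f : ℂ → ℂ} {a b : ℝ} (hab : a ≤ b)
    (hf : DifferentiableOn ℂ f (re ⁻¹' Set.Icc a b)) (h : StripDecay f a b) {z : ℝ} (hz : 0 < z) :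
    mellinInv a f z = mellinInv b f z := by
  have hz' : (z : ℂ) ≠ 0 := by exact_mod_cast hz.ne'
  obtain ⟨M, hM⟩ := exists_norm_cpow_le hz 0 a b
  have hd : Differentiable ℂ fun s : ℂ => (z : ℂ) ^ (-s) := fun s =>
    (differentiableAt_id.neg).const_cpow (Or.inl hz')
  have := integral_vertical_eq hab (hd.differentiableOn.mul hf)
    (h.mul_bounded (M := M) (fun s hs => by simpa using hM s hs))
  simp only [mellinInv, smul_eq_mul]
  exact congrArg _ this

/-- The value of `H` does not depend on the abscissa of the contour. -/
theorem foxH_Z_eq (hα0 : 0 < α) (hα1 : α < 1) (hβ0 : 0 < β) {a b : ℝ}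
    (ha : a ∈ Set.Ioo 0 (min 1 (d / β))) (hb : b ∈ Set.Ioo 0 (min 1 (d / β))) {z : ℝ}
    (hz : 0 < z) :
    foxH 1 2 (paramA β d) (paramZ α) a z = foxH 1 2 (paramA β d) (paramZ α) b z := by
  wlog hab : a ≤ b generalizing a b
  · exact (this hb ha (le_of_not_ge hab)).symm
  have h1 := hb.2.trans_le (min_le_left _ _)
  have h2 := hb.2.trans_le (min_le_right _ _)
  exact mellinInv_eq_of_stripDecay hab (differentiableOn_foxSymbol_Z hβ0 ha.1 h2
    (one_sub_ne_neg_natCast h1)) (stripDecay_foxSymbol_Z hα0 hα1 hβ0 ha.1 h2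
    (one_sub_ne_neg_natCast h1)) hz

theorem contour_mem (hβ0 : 0 < β) (hd : 1 ≤ d) :
    contour β d ∈ Set.Ioo 0 (min 1 ((d : ℝ) / β)) := by
  have hd' : (0 : ℝ) < d := by exact_mod_cast hd
  have : 0 < min 1 ((d : ℝ) / β) := lt_min one_pos (by positivity)
  constructor <;> simp only [contour] <;> linarith

theorem exists_norm_foxH_Z_le (hα0 : 0 < α) (hα1 : α < 1) (hβ0 : 0 < β) (hd : 1 ≤ d) {c : ℝ}
    (hc : c ∈ Set.Ioo 0 (min 1 ((d : ℝ) / β))) :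
    ∃ C : ℝ, ∀ z : ℝ, 0 < z →
      ‖foxH 1 2 (paramA β d) (paramZ α) (contour β d) z‖ ≤ C * z ^ (-c) := by
  refine ⟨1 / (2 * Real.pi) * ∫ y : ℝ, ‖foxSymbol 1 2 (paramA β d) (paramZ α) (c + y * I)‖,
    fun z hz => ?_⟩
  rw [foxH_Z_eq hα0 hα1 hβ0 (contour_mem hβ0 hd) hc hz]
  exact norm_mellinInv_le _ _ hz

/-- The function `𝓗(s) (z^{1-s} - 1)`, `𝓗` the symbol of `Z`, up to sign and with the singularity
at `s = 1` removed. -/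
def shiftedSymbol (α β : ℝ) (d : ℕ) (z : ℝ) (s : ℂ) : ℂ :=
  Gamma s * (Gamma (d / 2 - β / 2 * s) * Gamma (2 - s)) *
    ((Gamma (β / 2 * s))⁻¹ * (Gamma (1 - α * s))⁻¹) * dslope (fun w => (z : ℂ) ^ (1 - w)) 1 s

/-- The factor `z^{1-s} - 1` vanishes at `s = 1` and cancels the simple pole of `Γ(1 - s)`: the
denominator `s - 1` of the slope meets `Γ(2 - s) = (1 - s)Γ(1 - s)`. -/
theorem shiftedSymbol_eq (z : ℝ) {s : ℂ} (hs : s ≠ 1) :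
    shiftedSymbol α β d z s =
      -(foxSymbol 1 2 (paramA β d) (paramZ α) s * ((z : ℂ) ^ (1 - s) - 1)) := by
  have h1 : 1 - s ≠ 0 := sub_ne_zero.2 hs.symm
  have h2 : s - 1 ≠ 0 := sub_ne_zero.2 hs
  have h3 : Gamma (2 - s) = (1 - s) * Gamma (1 - s) := by
    rw [← Gamma_add_one _ h1]; ring_nf
  rw [shiftedSymbol, foxSymbol_Z, dslope_of_ne _ hs, slope_def_field, h3]
  simp only [sub_self, cpow_zero]
  field_simp
  ring

theorem differentiableOn_shiftedSymbol (hβ0 : 0 < β) {a b : ℝ} (ha : 0 < a) (hb : b < d / β)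
    (hb1 : b < 2) {z : ℝ} (hz : 0 < z) :
    DifferentiableOn ℂ (shiftedSymbol α β d z) (re ⁻¹' Set.Icc a b) := by
  have hz' : (z : ℂ) ≠ 0 := by exact_mod_cast hz.ne'
  refine (((differentiableOn_Gamma_comp differentiable_id fun s hs =>
      ne_neg_natCast_of_pos (ha.trans_le hs.1)).mul
    ((differentiableOn_Gamma_comp (by fun_prop) fun s hs =>
      ne_neg_natCast_of_pos (half_sub_re_pos hβ0 hb hs.2)).mul
      (differentiableOn_Gamma_comp (by fun_prop) fun s hs => ne_neg_natCast_of_pos ?_))).mul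
    ((differentiable_inv_Gamma_comp (by fun_prop)).mul
      (differentiable_inv_Gamma_comp (by fun_prop))).differentiableOn).mul ?_
  · have := hs.2
    simp only [sub_re, re_ofNat]
    linarith
  · refine DifferentiableOn.mono (t := Set.univ) ?_ (Set.subset_univ _)
    refine (differentiableOn_dslope univ_mem).2 fun s _ => ?_
    exact (((differentiableAt_const _).sub differentiableAt_id).const_cpow
      (Or.inl hz')).differentiableWithinAt

theorem stripDecay_shiftedSymbol (hα0 : 0 < α) (hα1 : α < 1) (hβ0 : 0 < β) {a b : ℝ}
    (ha : 0 < a) (hb : b < d / β) (hb1 : b < 2) {z : ℝ} (hz : 0 < z) :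
    StripDecay (shiftedSymbol α β d z) a b := by
  obtain ⟨C, ε, hε, h⟩ := exists_norm_foxSymbol_Z_le hα0 hα1 hβ0 ha hb
  obtain ⟨M, hM⟩ := exists_norm_cpow_le hz 1 a b
  refine stripDecay_of_large (C := C * (M + 1))
    (differentiableOn_shiftedSymbol hβ0 ha hb hb1 hz).continuousOn hε fun σ hσ y hy => ?_
  have hne : (σ + y * I : ℂ) ≠ 1 := by
    intro h
    have := congrArg im h
    simp at this
    rw [this] at hy
    norm_num at hy
  have h1 := hM (σ + y * I) (by simpa using hσ)
  have h2 := (norm_sub_le ((z : ℂ) ^ (1 - (σ + y * I : ℂ))) 1).trans (add_le_add_left h1 _)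
  rw [norm_one] at h2
  rw [shiftedSymbol_eq z hne, norm_neg, norm_mul]
  have h3 := h σ hσ y hy
  calc _ ≤ C * Real.exp (-ε * |y|) * (M + 1) :=
        mul_le_mul h3 h2 (norm_nonneg _) ((norm_nonneg _).trans h3)
    _ = _ := by ring

/-- For `z ≤ 1` the contour `Re s = 1/2` suffices. For `z ≥ 1` the pole at `s = 1` must be crossed;
moving `𝓗(s)(z^{1-s} - 1)`, `𝓗` the symbol, which has no pole there, to `Re s = 3/2` avoids
computing a residue. -/
theorem exists_norm_foxH_Z_le_inv (hα0 : 0 < α) (hα1 : α < 1) (hβ0 : 0 < β)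
    (hd : 2 * β ≤ d) :
    ∃ C : ℝ, ∀ z : ℝ, 0 < z →
      ‖foxH 1 2 (paramA β d) (paramZ α) (contour β d) z‖ ≤ C * z ^ (-1 : ℝ) := by
  have hdβ : 2 ≤ (d : ℝ) / β := (le_div_iff₀ hβ0).2 hd
  have hcon : contour β d = 1 / 2 := by rw [contour, min_eq_left (by linarith)]
  set φ := foxSymbol 1 2 (paramA β d) (paramZ α) with hφ
  have hint : Integrable fun y : ℝ => φ ((1 / 2 : ℝ) + y * I) :=
    integrable_foxSymbol_Z hα0 hα1 hβ0 (by norm_num) (by linarith)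
      (one_sub_ne_neg_natCast (by norm_num) _ (Set.right_mem_Icc.2 le_rfl))
  have hint2 : Integrable fun y : ℝ => φ ((3 / 2 : ℝ) + y * I) := by
    refine integrable_foxSymbol_Z hα0 hα1 hβ0 (by norm_num) (by linarith) fun m h => ?_
    have h2 : ((2 * m : ℕ) : ℝ) = (1 : ℕ) := by push_cast; linarith
    have h3 : 2 * m = 1 := by exact_mod_cast h2
    lia
  have hne (c y : ℝ) (hc : c ≠ 1) : (c + y * I : ℂ) ≠ 1 := by
    intro h
    exact hc (by simpa using congrArg re h)
  set A := ∫ y : ℝ, ‖φ ((1 / 2 : ℝ) + y * I)‖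
  set B := ∫ y : ℝ, ‖φ ((3 / 2 : ℝ) + y * I)‖
  have hA : 0 ≤ A := integral_nonneg fun _ => norm_nonneg _
  have hB : 0 ≤ B := integral_nonneg fun _ => norm_nonneg _
  have hp : (0 : ℝ) < 1 / (2 * Real.pi) := by have := Real.pi_pos; positivity
  refine ⟨1 / (2 * Real.pi) * A + 1 / (2 * Real.pi) * (2 * B), fun z hz => ?_⟩
  rw [hcon]
  rcases le_total z 1 with hz1 | hz1
  · refine (norm_mellinInv_le _ _ hz).trans ?_
    refine mul_le_mul ?_ ?_ (by positivity) (by positivity)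
    · have : 0 ≤ 1 / (2 * Real.pi) * (2 * B) := by positivity
      linarith
    · exact Real.rpow_le_rpow_of_exponent_ge hz hz1 (by norm_num)
  -- The strip is admissible since `3/2 < 2 ≤ d/β`. On its left edge the integral is `z ∫ z^{-s} 𝓗 -
  -- ∫ 𝓗`; on its right edge `|z^{1-s} - 1| ≤ 2`. So `z |∫ z^{-s} 𝓗| ≤ A + 2B`.
  · have hshift := integral_vertical_eq (a := (1 / 2 : ℝ)) (b := (3 / 2 : ℝ)) (by norm_num)
      (differentiableOn_shiftedSymbol (α := α) hβ0 (by norm_num) (by linarith) (by norm_num) hz)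
      (stripDecay_shiftedSymbol hα0 hα1 hβ0 (d := d) (by norm_num) (by linarith) (by norm_num) hz)
    simp_rw [shiftedSymbol_eq z (hne _ _ (by norm_num : (1 / 2 : ℝ) ≠ 1)),
      shiftedSymbol_eq z (hne _ _ (by norm_num : (3 / 2 : ℝ) ≠ 1)), integral_neg, neg_inj,
      ← hφ] at hshift
    have hz' : (z : ℂ) ≠ 0 := by exact_mod_cast hz.ne'
    have hsplit (s : ℂ) : φ s * ((z : ℂ) ^ (1 - s) - 1) =
        (z : ℂ) * ((z : ℂ) ^ (-s) • φ s) - φ s := by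
      rw [sub_eq_add_neg 1 s, cpow_add _ _ hz', cpow_one, smul_eq_mul]; ring
    have hint3 : Integrable fun y : ℝ =>
        (z : ℂ) ^ (-(((1 / 2 : ℝ) : ℂ) + y * I)) • φ ((1 / 2 : ℝ) + y * I) := by
      have hcont : Continuous fun y : ℝ => (z : ℂ) ^ (-(((1 / 2 : ℝ) : ℂ) + y * I)) :=
        Continuous.const_cpow (by fun_prop) (Or.inl hz')
      refine (hint.norm.const_mul (z ^ (-(1 / 2 : ℝ)))).mono'
        (hcont.aestronglyMeasurable.smul hint.aestronglyMeasurable) ?_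
      · refine Eventually.of_forall fun y => ?_
        rw [norm_smul, norm_cpow_neg_vertical hz]
    have hlhs : ∫ y : ℝ, φ ((1 / 2 : ℝ) + y * I) *
        ((z : ℂ) ^ (1 - (((1 / 2 : ℝ) : ℂ) + y * I)) - 1) =
        z * (∫ y : ℝ, (z : ℂ) ^ (-(((1 / 2 : ℝ) : ℂ) + y * I)) • φ ((1 / 2 : ℝ) + y * I)) -
          ∫ y : ℝ, φ ((1 / 2 : ℝ) + y * I) := by
      simp_rw [hsplit]
      rw [integral_sub (hint3.const_mul _) hint, integral_const_mul]
    have hrhs : ‖∫ y : ℝ, φ ((3 / 2 : ℝ) + y * I) *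
        ((z : ℂ) ^ (1 - (((3 / 2 : ℝ) : ℂ) + y * I)) - 1)‖ ≤ 2 * B := by
      rw [← integral_const_mul]
      refine norm_integral_le_of_norm_le (hint2.norm.const_mul 2) (Eventually.of_forall fun y => ?_)
      have h1 : ‖(z : ℂ) ^ (1 - (((3 / 2 : ℝ) : ℂ) + y * I)) - 1‖ ≤ 2 := by
        refine (norm_sub_le _ _).trans ?_
        rw [norm_cpow_eq_rpow_re_of_pos hz, norm_one]
        have : z ^ (1 - (((3 / 2 : ℝ) : ℂ) + y * I)).re ≤ 1 :=
          Real.rpow_le_one_of_one_le_of_nonpos hz1 (by simp; norm_num)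
        linarith
      rw [norm_mul, mul_comm]
      gcongr
    rw [← hshift, hlhs] at hrhs
    have hφA : ‖∫ y : ℝ, φ ((1 / 2 : ℝ) + y * I)‖ ≤ A := norm_integral_le_integral_norm _
    have hfin : ‖(z : ℂ) * ∫ y : ℝ, (z : ℂ) ^ (-(((1 / 2 : ℝ) : ℂ) + y * I)) •
        φ ((1 / 2 : ℝ) + y * I)‖ ≤ A + 2 * B := by
      have := norm_le_norm_add_norm_sub' ((z : ℂ) * ∫ y : ℝ,
        (z : ℂ) ^ (-(((1 / 2 : ℝ) : ℂ) + y * I)) • φ ((1 / 2 : ℝ) + y * I))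
        (∫ y : ℝ, φ ((1 / 2 : ℝ) + y * I))
      linarith
    rw [norm_mul, norm_real, Real.norm_of_nonneg hz.le] at hfin
    rw [foxH, mellinInv, norm_smul, Real.norm_of_nonneg hp.le, Real.rpow_neg_one, ← mul_add,
      mul_assoc]
    refine mul_le_mul_of_nonneg_left ?_ hp.le
    rw [← div_eq_mul_inv, le_div_iff₀ hz, mul_comm]
    exact hfin

end FoxH

/-! ### Pointwise bounds and measurability of the fundamental solution -/

section FundZ

open Filter

variable {α β : ℝ} {d : ℕ}

theorem exists_norm_fundZ_le (hd : 1 ≤ d) {c : ℝ}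
    (h : ∃ C : ℝ, ∀ z : ℝ, 0 < z →
      ‖foxH 1 2 (paramA β d) (paramZ α) (contour β d) z‖ ≤ C * z ^ (-c)) :
    ∃ C : ℝ, 0 < C ∧ ∀ t : ℝ, 0 < t → ∀ x : EuclideanSpace ℝ (Fin d),
      ‖fundZ α β t x‖ ≤ C * t ^ (-(α * c)) * ‖x‖ ^ (β * c - d) := by
  obtain ⟨C, h⟩ := h
  have hpi := Real.pi_pos
  refine ⟨Real.pi ^ (-(d : ℝ) / 2) * (max C 1 * 2 ^ (-(β * c))), by positivity,
    fun t ht x => ?_⟩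
  have hd' : (0 : ℝ) < d := by exact_mod_cast hd
  -- At the origin the convention `0 ^ (-d) = 0` gives `Z(t, 0) = 0`, and the bound is trivial.
  rcases (norm_nonneg x).eq_or_lt with hx | hx
  · rw [fundZ, ← hx, Real.zero_rpow (by linarith : -(d : ℝ) ≠ 0)]
    simp only [mul_zero, Complex.ofReal_zero, zero_mul, norm_zero]
    positivity
  · have hz : 0 < 2 ^ β * t ^ α * ‖x‖ ^ (-β) := by positivity
    have h1 := (h _ hz).trans (mul_le_mul_of_nonneg_right (le_max_left C 1) (by positivity))
    rw [Real.mul_rpow (by positivity) (by positivity), Real.mul_rpow (by positivity)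
      (by positivity), ← Real.rpow_mul (by norm_num), ← Real.rpow_mul ht.le,
      ← Real.rpow_mul hx.le, mul_neg, mul_neg, neg_mul_neg] at h1
    rw [fundZ, norm_mul, Complex.norm_real, Real.norm_of_nonneg (by positivity),
      sub_eq_add_neg (β * c), Real.rpow_add hx]
    calc _ ≤ Real.pi ^ (-(d : ℝ) / 2) * ‖x‖ ^ (-(d : ℝ)) *
          (max C 1 * (2 ^ (-(β * c)) * t ^ (-(α * c)) * ‖x‖ ^ (β * c))) := by gcongr
      _ = _ := by ring

theorem measurable_fundZ (hβ0 : 0 < β) (hd : 1 ≤ d) (t : ℝ) :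
    Measurable (fundZ α β t : EuclideanSpace ℝ (Fin d) → ℂ) := by
  have hc := contour_mem hβ0 hd
  have hφ : Measurable fun y : ℝ => foxSymbol 1 2 (paramA β d) (paramZ α)
      (contour β d + y * Complex.I) := by
    have h1 := hc.2.trans_le (min_le_left _ _)
    have h2 := hc.2.trans_le (min_le_right _ _)
    exact ((differentiableOn_foxSymbol_Z hβ0 hc.1 h2 (one_sub_ne_neg_natCast h1)).continuousOn.comp_continuous
      (by fun_prop) fun y => by simp).measurable
  have hH : Measurable (foxH 1 2 (paramA β d) (paramZ α) (contour β d)) := by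
    have : StronglyMeasurable (fun p : ℝ × ℝ => ((p.1 : ℂ) ^ (-(contour β d + p.2 * Complex.I)) •
        foxSymbol 1 2 (paramA β d) (paramZ α) (contour β d + p.2 * Complex.I))) := by
      have hp : Measurable fun p : ℝ × ℝ =>
          (p.1 : ℂ) ^ (-((contour β d : ℂ) + p.2 * Complex.I)) :=
        Measurable.pow (by fun_prop) (by fun_prop)
      exact (hp.smul (hφ.comp measurable_snd)).stronglyMeasurable
    exact (this.integral_prod_right'.const_smul (1 / (2 * Real.pi))).measurable
  unfold fundZ
  refine Measurable.mul ?_ (hH.comp ?_)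
  · exact Complex.measurable_ofReal.comp ((measurable_norm.pow_const _).const_mul _)
  · exact (measurable_norm.pow_const _).const_mul _

end FundZ

/-! ### Convolution with kernels bounded by powers of the norm -/

section Kernels

open Metric

variable {d : ℕ} {K g : EuclideanSpace ℝ (Fin d) → ℝ≥0∞}

theorem setLIntegral_pow_le {B p : ℝ} (hB : 0 ≤ B) (hK : ∀ x, K x ≤ ENNReal.ofReal (B * ‖x‖ ^ p))
    (n : ℕ) (S : Set (EuclideanSpace ℝ (Fin d))) :
    ∫⁻ x in S, K x ^ n ≤
      ENNReal.ofReal (B ^ n) * ∫⁻ x in S, ENNReal.ofReal (‖x‖ ^ (n * p)) := by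
  rw [← lintegral_const_mul _ (by fun_prop)]
  refine lintegral_mono fun x => (pow_le_pow_left' (hK x) n).trans_eq ?_
  rw [← ENNReal.ofReal_pow (by positivity), ← ENNReal.ofReal_mul (by positivity), mul_pow,
    mul_comm (n : ℝ) p, Real.rpow_mul_natCast (norm_nonneg x)]

theorem exists_setLIntegral_closedBall_le (hd : 1 ≤ d) {n : ℕ} {p : ℝ} (hp : -(d : ℝ) < n * p) :
    ∃ A : ℝ, 0 < A ∧ ∀ (K : EuclideanSpace ℝ (Fin d) → ℝ≥0∞) (B R : ℝ), 0 ≤ B → 0 < R →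
      (∀ x, K x ≤ ENNReal.ofReal (B * ‖x‖ ^ p)) →
      ∫⁻ x in closedBall 0 R, K x ^ n ≤ ENNReal.ofReal (B ^ n * (A * R ^ (n * p + d))) := by
  obtain ⟨A, hA, h⟩ := exists_lintegral_norm_rpow_Iic_le hd hp
  refine ⟨A, hA, fun K B R hB hR hK => (setLIntegral_pow_le hB hK n _).trans ?_⟩
  rw [ENNReal.ofReal_mul (by positivity), ← lintegral_indicator measurableSet_closedBall]
  refine mul_le_mul_right ((lintegral_mono fun x => ?_).trans (h R hR)) _
  by_cases hx : ‖x‖ ≤ R <;> simp [hx]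

theorem exists_setLIntegral_compl_closedBall_le (hd : 1 ≤ d) {n : ℕ} {p : ℝ}
    (hp : n * p < -(d : ℝ)) :
    ∃ A : ℝ, 0 < A ∧ ∀ (K : EuclideanSpace ℝ (Fin d) → ℝ≥0∞) (B R : ℝ), 0 ≤ B → 0 < R →
      (∀ x, K x ≤ ENNReal.ofReal (B * ‖x‖ ^ p)) →
      ∫⁻ x in (closedBall 0 R)ᶜ, K x ^ n ≤ ENNReal.ofReal (B ^ n * (A * R ^ (n * p + d))) := by
  obtain ⟨A, hA, h⟩ := exists_lintegral_norm_rpow_Ioi_le hd hp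
  refine ⟨A, hA, fun K B R hB hR hK => (setLIntegral_pow_le hB hK n _).trans ?_⟩
  rw [ENNReal.ofReal_mul (by positivity), ← lintegral_indicator measurableSet_closedBall.compl]
  refine mul_le_mul_right ((lintegral_mono fun x => ?_).trans (h R hR)) _
  by_cases hx : ‖x‖ ≤ R
  · simp [hx]
  · simp [hx, not_le.1 hx]

theorem indicator_compl_closedBall_le {B p R : ℝ} (hB : 0 ≤ B) (hR : 0 < R) (hp : p ≤ 0)
    (hK : ∀ x, K x ≤ ENNReal.ofReal (B * ‖x‖ ^ p)) (x : EuclideanSpace ℝ (Fin d)) :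
    (closedBall 0 R)ᶜ.indicator K x ≤ ENNReal.ofReal (B * R ^ p) := by
  by_cases hx : ‖x‖ ≤ R
  · simp [hx]
  · rw [Set.indicator_of_mem (by simpa using hx)]
    refine (hK x).trans (ENNReal.ofReal_le_ofReal (mul_le_mul_of_nonneg_left ?_ hB))
    exact Real.rpow_le_rpow_of_nonpos hR (not_le.1 hx).le hp

theorem lconv_eq_near_add_far (hK : Measurable K) (hg : Measurable g) (R : ℝ) :
    lconv volume K g = lconv volume ((closedBall 0 R).indicator K) g +
      lconv volume ((closedBall 0 R)ᶜ.indicator K) g := by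
  rw [← lconv_add (hK.indicator measurableSet_closedBall) hg, Set.indicator_self_add_compl]

theorem eLpNorm_two_le {f : EuclideanSpace ℝ (Fin d) → ℝ≥0∞} {a : ℝ} (ha : 0 ≤ a)
    (h : ∫⁻ x, f x ^ 2 ≤ ENNReal.ofReal (a ^ 2)) : eLpNorm f 2 volume ≤ ENNReal.ofReal a := by
  have h2 := ENNReal.rpow_le_rpow h (show (0 : ℝ) ≤ 1 / 2 by norm_num)
  rw [ENNReal.ofReal_pow ha, ← ENNReal.rpow_natCast, ← ENNReal.rpow_mul] at h2
  norm_num at h2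
  simpa [eLpNorm_eq_lintegral_rpow_enorm_toReal] using h2

theorem lintegral_indicator_pow {S : Set (EuclideanSpace ℝ (Fin d))} (hS : MeasurableSet S)
    {n : ℕ} (hn : n ≠ 0) : ∫⁻ x, S.indicator K x ^ n = ∫⁻ x in S, K x ^ n := by
  rw [← lintegral_indicator hS]
  congr 1; funext x
  by_cases hx : x ∈ S <;> simp [hx, hn]

/-- Near the origin the kernel is integrable, so its convolution with `g` is integrable and finite
almost everywhere; away from the origin it is bounded. -/
theorem ae_lconv_lt_top (hd : 1 ≤ d) (hK : Measurable K) (hg : Measurable g)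
    (hg1 : ∫⁻ x, g x ≠ ∞) {B p : ℝ} (hB : 0 ≤ B) (hp : -(d : ℝ) < p) (hp0 : p ≤ 0)
    (hKB : ∀ x, K x ≤ ENNReal.ofReal (B * ‖x‖ ^ p)) : ∀ᵐ x, lconv volume K g x < ∞ := by
  obtain ⟨A, -, hA⟩ := exists_setLIntegral_closedBall_le hd (n := 1) (p := p) (by simpa using hp)
  have hm : Measurable ((closedBall 0 1).indicator K) := hK.indicator measurableSet_closedBall
  have h1 := hA K B 1 hB one_pos hKB
  rw [← lintegral_indicator_pow measurableSet_closedBall one_ne_zero] at h1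
  simp only [pow_one] at h1
  have h2 : ∫⁻ x, lconv volume ((closedBall 0 1).indicator K) g x ≠ ∞ := by
    rw [lintegral_lconv hm hg]
    exact ENNReal.mul_ne_top (h1.trans_lt ENNReal.ofReal_lt_top).ne hg1
  filter_upwards [ae_lt_top (measurable_lconv hm hg) h2] with x hx
  rw [lconv_eq_near_add_far hK hg 1]
  refine ENNReal.add_lt_top.2 ⟨hx, ?_⟩
  refine (lconv_le_mul_lintegral hg (indicator_compl_closedBall_le hB one_pos hp0 hKB) x).trans_lt ?_
  exact ENNReal.mul_lt_top ENNReal.ofReal_lt_top hg1.lt_top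

/-- A kernel bounded by two powers of `|x|`, square integrable near and away from the origin. -/
theorem exists_eLpNorm_two_kernel_le (hd : 1 ≤ d) {p q : ℝ} (hp : -(d : ℝ) < 2 * p)
    (hq : 2 * q < -(d : ℝ)) :
    ∃ A : ℝ, 0 < A ∧ ∀ (K : EuclideanSpace ℝ (Fin d) → ℝ≥0∞) (B B' R : ℝ), Measurable K →
      0 ≤ B → 0 ≤ B' → 0 < R → (∀ x, K x ≤ ENNReal.ofReal (B * ‖x‖ ^ p)) →
      (∀ x, K x ≤ ENNReal.ofReal (B' * ‖x‖ ^ q)) →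
      eLpNorm K 2 volume ≤
        ENNReal.ofReal (A * (B * R ^ (p + d / 2) + B' * R ^ (q + d / 2))) := by
  obtain ⟨A, hA0, hA⟩ := exists_setLIntegral_closedBall_le hd (n := 2) (p := p) (by simpa using hp)
  obtain ⟨A', hA0', hA'⟩ := exists_setLIntegral_compl_closedBall_le hd (n := 2) (p := q)
    (by simpa using hq)
  -- The summand `1` makes the constant at most its own square, which dispenses with square roots.
  refine ⟨A + A' + 1, by positivity, fun K B B' R hK hB hB' hR h h' => ?_⟩
  refine eLpNorm_two_le (by positivity) ?_
  rw [← lintegral_add_compl _ (measurableSet_closedBall (x := 0) (ε := R))]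
  refine (add_le_add (hA K B R hB hR h) (hA' K B' R hB' hR h')).trans ?_
  rw [← ENNReal.ofReal_add (by positivity) (by positivity)]
  refine ENNReal.ofReal_le_ofReal ?_
  have e (s : ℝ) : R ^ (((2 : ℕ) : ℝ) * s + d) = (R ^ (s + d / 2)) ^ 2 := by
    rw [← Real.rpow_natCast, ← Real.rpow_mul hR.le]
    congr 1; push_cast; ring
  rw [e, e]
  set X := R ^ (p + d / 2)
  set Y := R ^ (q + d / 2)
  have hX : 0 ≤ B * X := by positivity
  have hY : 0 ≤ B' * Y := by positivity
  calc B ^ 2 * (A * X ^ 2) + B' ^ 2 * (A' * Y ^ 2) = A * (B * X) ^ 2 + A' * (B' * Y) ^ 2 := by ring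
    _ ≤ (A + A' + 1) * (B * X) ^ 2 + (A + A' + 1) * (B' * Y) ^ 2 := by gcongr <;> linarith
    _ = (A + A' + 1) * ((B * X) ^ 2 + (B' * Y) ^ 2) := by ring
    _ ≤ (A + A' + 1) ^ 2 * (B * X + B' * Y) ^ 2 := by
        gcongr
        · exact le_self_pow₀ (by linarith) two_ne_zero
        · nlinarith [mul_nonneg hX hY]
    _ = _ := by ring

/-- Convolution with a kernel bounded by a power of `|x|` that is integrable near the origin and
square integrable away from it. -/
theorem exists_eLpNorm_lconv_le (hd : 1 ≤ d) {p : ℝ} (hp : -(d : ℝ) < p)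
    (hq : 2 * p < -(d : ℝ)) :
    ∃ A : ℝ, 0 < A ∧ ∀ (K g : EuclideanSpace ℝ (Fin d) → ℝ≥0∞) (B : ℝ), Measurable K →
      Measurable g → 0 ≤ B → (∀ x, K x ≤ ENNReal.ofReal (B * ‖x‖ ^ p)) →
      eLpNorm (lconv volume K g) 2 volume ≤
        ENNReal.ofReal (A * B) * (eLpNorm g 1 volume + eLpNorm g 2 volume) := by
  obtain ⟨A, hA0, hA⟩ := exists_setLIntegral_closedBall_le hd (n := 1) (p := p) (by simpa using hp)
  obtain ⟨A', hA0', hA'⟩ := exists_setLIntegral_compl_closedBall_le hd (n := 2) (p := p)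
    (by simpa using hq)
  refine ⟨max A (√A'), lt_max_of_lt_left hA0, fun K g B hK hg hB h => ?_⟩
  have hn : Measurable ((closedBall 0 1).indicator K) := hK.indicator measurableSet_closedBall
  have hf : Measurable ((closedBall 0 1)ᶜ.indicator K) :=
    hK.indicator measurableSet_closedBall.compl
  have h1 : eLpNorm ((closedBall 0 1).indicator K) 1 volume ≤
      ENNReal.ofReal (max A (√A') * B) := by
    have := hA K B 1 hB one_pos h
    rw [← lintegral_indicator_pow measurableSet_closedBall one_ne_zero] at this
    simp only [pow_one, Real.one_rpow, mul_one] at this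
    rw [eLpNorm_one_eq_lintegral_enorm]
    refine this.trans (ENNReal.ofReal_le_ofReal ?_)
    rw [mul_comm]
    gcongr
    exact le_max_left _ _
  have h2 : eLpNorm ((closedBall 0 1)ᶜ.indicator K) 2 volume ≤
      ENNReal.ofReal (max A (√A') * B) := by
    refine eLpNorm_two_le (by positivity) ?_
    rw [lintegral_indicator_pow measurableSet_closedBall.compl two_ne_zero]
    refine (hA' K B 1 hB one_pos h).trans (ENNReal.ofReal_le_ofReal ?_)
    rw [Real.one_rpow, mul_one, mul_pow, mul_comm]
    gcongr
    calc A' = √A' ^ 2 := (Real.sq_sqrt hA0'.le).symm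
      _ ≤ _ := by gcongr; exact le_max_right _ _
  -- The far part is estimated by `L² * L¹`, the near part by `L¹ * L²`.
  rw [lconv_eq_near_add_far hK hg 1]
  refine (eLpNorm_add_le (measurable_lconv hn hg).aestronglyMeasurable
    (measurable_lconv hf hg).aestronglyMeasurable one_le_two).trans ?_
  rw [mul_add, add_comm]
  refine add_le_add ?_ ?_
  · rw [lconv_comm]
    refine (eLpNorm_lconv_le hg hf).trans ?_
    rw [mul_comm]
    gcongr
  · refine (eLpNorm_lconv_le hn hg).trans ?_
    gcongr

/-- The weak type inequality for convolution with a kernel bounded by `|x|^{-d/2}`. -/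
theorem exists_weak_lconv_le (hd : 1 ≤ d) :
    ∃ A : ℝ, 0 < A ∧ ∀ (K g : EuclideanSpace ℝ (Fin d) → ℝ≥0∞) (B : ℝ), Measurable K →
      Measurable g → ∫⁻ x, g x ≠ ∞ → 0 < B →
      (∀ x, K x ≤ ENNReal.ofReal (B * ‖x‖ ^ (-(d : ℝ) / 2))) → ∀ r : ℝ≥0,
      (r : ℝ≥0∞) * volume {x | r < lconv volume K g x} ^ (1 / 2 : ℝ) ≤
        ENNReal.ofReal (A * B) * ∫⁻ x, g x := by
  have hd' : (0 : ℝ) < d := by exact_mod_cast hd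
  obtain ⟨A, hA0, hA⟩ := exists_setLIntegral_closedBall_le hd (n := 1) (p := -(d : ℝ) / 2)
    (by simp; linarith)
  refine ⟨2 * √A, by positivity, fun K g B hK hg hg1 hB h r => ?_⟩
  rcases eq_or_ne r 0 with rfl | hr
  · simp
  have hr0 : (0 : ℝ) < r := by positivity
  have hfar (R : ℝ) (hR : 0 < R) (x : EuclideanSpace ℝ (Fin d)) :=
    lconv_le_mul_lintegral (μ := volume) hg
      (indicator_compl_closedBall_le hB.le hR (by linarith) h) x
  set G := (∫⁻ x, g x).toReal with hG
  have hGe : ∫⁻ x, g x = ENNReal.ofReal G := (ENNReal.ofReal_toReal hg1).symm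
  have hG' : 0 ≤ G := ENNReal.toReal_nonneg
  rcases hG'.eq_or_lt with h0 | hG0
  · have hz : ∫⁻ x, g x = 0 := by rw [hGe, ← h0, ENNReal.ofReal_zero]
    have hl : lconv volume K g = 0 := by
      rw [lintegral_eq_zero_iff hg] at hz
      rw [lconv_congr_ae hz]
      funext x
      simp [lconv]
    simp [hl]
  -- This radius makes the bound `B R^{-d/2} G` of the far part equal to `r/2`. Where the
  -- convolution exceeds `r`, the near part is then at least `r/2`, and Markov's inequality applies
  -- to it.
  set R : ℝ := (2 * B * G / r) ^ (2 / (d : ℝ)) with hR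
  have hR0 : 0 < R := by positivity
  have hRd : R ^ ((d : ℝ) / 2) = 2 * B * G / r := by
    rw [hR, ← Real.rpow_mul (by positivity), div_mul_div_cancel₀ (by positivity)]
    simp
  have hRd' : R ^ (-(d : ℝ) / 2) = r / (2 * B * G) := by
    rw [neg_div, Real.rpow_neg hR0.le, hRd, inv_div]
  have hm : Measurable ((closedBall 0 R).indicator K) := hK.indicator measurableSet_closedBall
  have hnear : ∫⁻ x, lconv volume ((closedBall 0 R).indicator K) g x ≤
      ENNReal.ofReal (A * (2 * B * G) * (B * G) / r) := by
    have := hA K B R hB.le hR0 h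
    rw [← lintegral_indicator_pow measurableSet_closedBall one_ne_zero] at this
    simp only [pow_one] at this
    rw [lintegral_lconv hm hg, hGe]
    refine (mul_le_mul_left this _).trans_eq ?_
    rw [← ENNReal.ofReal_mul (by positivity)]
    congr 1
    rw [show ((1 : ℕ) : ℝ) * (-(d : ℝ) / 2) + d = d / 2 by push_cast; ring, hRd]
    ring
  have hsub : {x | (r : ℝ≥0∞) < lconv volume K g x} ⊆
      {x | ENNReal.ofReal (r / 2) ≤ lconv volume ((closedBall 0 R).indicator K) g x} := by
    intro x hx
    simp only [Set.mem_ofPred_eq] at hx ⊢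
    by_contra hlt
    refine hx.not_ge ?_
    rw [lconv_eq_near_add_far hK hg R, Pi.add_apply]
    refine (add_le_add (not_le.1 hlt).le (hfar R hR0 x)).trans_eq ?_
    rw [hGe, ← ENNReal.ofReal_mul (by positivity), ← ENNReal.ofReal_add (by positivity)
      (by positivity), hRd']
    rw [show (r : ℝ) / 2 + B * (r / (2 * B * G)) * G = r by field_simp; ring]
    exact ENNReal.ofReal_coe_nnreal
  have hmeas : volume {x | (r : ℝ≥0∞) < lconv volume K g x} ≤
      ENNReal.ofReal ((2 * √A * B * G / r) ^ 2) := by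
    have hr2 : ENNReal.ofReal (r / 2) ≠ 0 := by simpa using hr0
    have := (mul_meas_ge_le_lintegral (μ := volume) (measurable_lconv hm hg)
      (ENNReal.ofReal (r / 2))).trans hnear
    rw [mul_comm, ← ENNReal.le_div_iff_mul_le (Or.inl hr2) (Or.inl ENNReal.ofReal_ne_top),
      ← ENNReal.ofReal_div_of_pos (by positivity)] at this
    refine (measure_mono hsub).trans (this.trans_eq ?_)
    congr 1
    rw [div_pow, mul_pow, mul_pow, mul_pow, Real.sq_sqrt hA0.le]
    field_simp
  have h2 := ENNReal.rpow_le_rpow hmeas (show (0 : ℝ) ≤ 1 / 2 by norm_num)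
  rw [ENNReal.ofReal_pow (by positivity), ← ENNReal.rpow_natCast, ← ENNReal.rpow_mul] at h2
  norm_num at h2
  calc _ ≤ (r : ℝ≥0∞) * ENNReal.ofReal (2 * √A * B * G / r) := by
        gcongr
    _ = _ := by
        rw [hGe, ← ENNReal.ofReal_coe_nnreal, ← ENNReal.ofReal_mul hr0.le,
          ← ENNReal.ofReal_mul (by positivity)]
        congr 1
        field_simp

end Kernels

/-! ### Estimates for the mild solution -/

section Mild

variable {α β : ℝ} {d : ℕ} {u₀ : EuclideanSpace ℝ (Fin d) → ℂ}

theorem mildSolution_zero_right (t : ℝ) :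
    mildSolution α β u₀ 0 t = fun x => ∫ y, fundZ α β t (x - y) * u₀ y := by
  funext x
  simp [mildSolution]

theorem enorm_mildSolution_le (t : ℝ) (x : EuclideanSpace ℝ (Fin d)) :
    ‖mildSolution α β u₀ 0 t x‖ₑ ≤
      lconv volume (fun x => ‖fundZ α β t x‖ₑ) (fun y => ‖u₀ y‖ₑ) x := by
  rw [mildSolution_zero_right]
  refine (enorm_integral_le_lintegral_enorm _).trans_eq ?_
  simp [lconv]

theorem mildDefinedAt_of_lconv_lt_top {t : ℝ} (hZ : Measurable (fundZ α β (d := d) t))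
    (hu : AEStronglyMeasurable u₀ volume) {x : EuclideanSpace ℝ (Fin d)}
    (hx : lconv volume (fun x => ‖fundZ α β t x‖ₑ) (fun y => ‖u₀ y‖ₑ) x < ∞) :
    MildDefinedAt α β u₀ 0 t x := by
  refine ⟨⟨?_, ?_⟩, by simp⟩
  · exact (hZ.comp (measurable_const.sub measurable_id)).aestronglyMeasurable.mul hu
  · rw [hasFiniteIntegral_iff_enorm]
    simpa [lconv] using hx

theorem aestronglyMeasurable_mildSolution {t : ℝ} (hZ : Measurable (fundZ α β (d := d) t))
    (hu : AEStronglyMeasurable u₀ volume) :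
    AEStronglyMeasurable (mildSolution α β u₀ 0 t) volume := by
  rw [mildSolution_zero_right]
  have h : AEStronglyMeasurable (fun p : EuclideanSpace ℝ (Fin d) × EuclideanSpace ℝ (Fin d) =>
      fundZ α β t (p.1 - p.2) * u₀ p.2) (volume.prod volume) :=
    (hZ.comp (measurable_fst.sub measurable_snd)).aestronglyMeasurable.mul hu.comp_snd
  exact h.integral_prod_right'

theorem enorm_fundZ_le {C t p q : ℝ} {x : EuclideanSpace ℝ (Fin d)}
    (h : ‖fundZ α β t x‖ ≤ C * t ^ p * ‖x‖ ^ q) :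
    ‖fundZ α β t x‖ₑ ≤ ENNReal.ofReal (C * t ^ p * ‖x‖ ^ q) := by
  rw [← ofReal_norm]
  exact ENNReal.ofReal_le_ofReal h

/-- At the critical abscissa `e = d/(2β)` the bound is `|x|^{-d/2}`, which fails to be square
integrable at both ends. An abscissa above `e` repairs the origin, one below repairs infinity; both
lie in the admissible strip because `d < 2β`. -/
theorem exists_eLpNorm_fundZ_le (hα0 : 0 < α) (hα1 : α < 1) (hβ0 : 0 < β) (hd : 1 ≤ d)
    (h : (d : ℝ) < 2 * β) :
    ∃ C : ℝ, 0 < C ∧ ∀ t : ℝ, 0 < t →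
      eLpNorm (fun x : EuclideanSpace ℝ (Fin d) => ‖fundZ α β t x‖ₑ) 2 volume ≤
        ENNReal.ofReal (C * t ^ (-(α * (d / (2 * β))))) := by
  have hd' : (0 : ℝ) < d := by exact_mod_cast hd
  set e : ℝ := d / (2 * β) with he
  have he0 : 0 < e := by positivity
  have heβ : β * e = d / 2 := by rw [he]; field_simp
  have hlt : e < min 1 (d / β) := by
    refine lt_min ((div_lt_one (by positivity)).2 h) ?_
    rw [lt_div_iff₀ hβ0]
    linarith
  obtain ⟨c, hc1, hc2⟩ := exists_between hlt
  obtain ⟨C, hC, hZ⟩ := exists_norm_fundZ_le hd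
    (exists_norm_foxH_Z_le hα0 hα1 hβ0 hd (c := c) ⟨he0.trans hc1, hc2⟩)
  obtain ⟨C', hC', hZ'⟩ := exists_norm_fundZ_le hd
    (exists_norm_foxH_Z_le hα0 hα1 hβ0 hd (c := e / 2) ⟨by positivity, by linarith⟩)
  have h1 : β * e < β * c := by gcongr
  have h2 : β * (e / 2) < β * e := by gcongr; linarith
  obtain ⟨A, hA0, hA⟩ := exists_eLpNorm_two_kernel_le hd (p := β * c - d) (q := β * (e / 2) - d)
    (by linarith) (by linarith)
  refine ⟨A * (C + C'), by positivity, fun t ht => ?_⟩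
  -- Cutting at the self-similar radius `t^{α/β}` makes both contributions scale as `t^{-αe}`.
  refine (hA _ (C * t ^ (-(α * c))) (C' * t ^ (-(α * (e / 2)))) (t ^ (α / β))
    (measurable_fundZ hβ0 hd t).enorm (by positivity) (by positivity) (by positivity)
    (fun x => enorm_fundZ_le (hZ t ht x)) (fun x => enorm_fundZ_le (hZ' t ht x))).trans_eq ?_
  have hpow (c : ℝ) : t ^ (-(α * c)) * (t ^ (α / β)) ^ (β * c - d + d / 2) = t ^ (-(α * e)) := by
    rw [← Real.rpow_mul ht.le, ← Real.rpow_add ht]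
    congr 1
    rw [he]
    field_simp
    ring
  congr 1
  rw [mul_assoc C, mul_assoc C', hpow, hpow]
  ring

theorem exists_norm_fundZ_le_endpoint (hα0 : 0 < α) (hα1 : α < 1) (hβ0 : 0 < β) (hd : 1 ≤ d)
    (h : 2 * β ≤ d) :
    ∃ C : ℝ, 0 < C ∧ ∀ t : ℝ, 0 < t → ∀ x : EuclideanSpace ℝ (Fin d),
      ‖fundZ α β t x‖ₑ ≤ ENNReal.ofReal (C * t ^ (-α) * ‖x‖ ^ (β - d)) := by
  obtain ⟨C, hC, hZ⟩ := exists_norm_fundZ_le (c := 1) hd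
    (exists_norm_foxH_Z_le_inv hα0 hα1 hβ0 h)
  exact ⟨C, hC, fun t ht x => enorm_fundZ_le (by simpa using hZ t ht x)⟩

theorem weakLpNorm_two_le {f : EuclideanSpace ℝ (Fin d) → ℂ}
    {F : EuclideanSpace ℝ (Fin d) → ℝ≥0∞} {M : ℝ≥0∞} (hf : ∀ x, ‖f x‖ₑ ≤ F x)
    (h : ∀ r : ℝ≥0, (r : ℝ≥0∞) * volume {x | r < F x} ^ (1 / 2 : ℝ) ≤ M) :
    weakLpNorm f 2 ≤ M := by
  refine iSup_le fun r => le_trans ?_ (h r)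
  gcongr with x
  intro hx
  exact (ENNReal.coe_lt_coe.2 hx).trans_le (hf x)

/-- The sign of `d - 2β` decides whether `|x|^{β-d}` decays faster than, exactly like or slower than
`|x|^{-d/2}` at infinity. Only in the last case is the abscissa `1` replaced by two others around
`d/(2β)`. -/
theorem exists_mildSolution_bound (hα0 : 0 < α) (hα1 : α < 1) (hβ0 : 0 < β) (hd : 1 ≤ d) :
    ∃ C : ℝ, 0 < C ∧ ∀ g : EuclideanSpace ℝ (Fin d) → ℝ≥0∞, Measurable g →
      ∫⁻ x, g x ≠ ∞ → ∀ t : ℝ, 0 < t →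
        ((d : ℝ) ≠ 2 * β →
          eLpNorm (lconv volume (fun x => ‖fundZ α β t x‖ₑ) g) 2 volume ≤
            ENNReal.ofReal (C * t ^ (-(α * min 1 ((d : ℝ) / (2 * β))))) *
              (eLpNorm g 1 volume + eLpNorm g 2 volume)) ∧
        ((d : ℝ) = 2 * β → ∀ r : ℝ≥0,
          (r : ℝ≥0∞) * volume {x | r < lconv volume (fun x => ‖fundZ α β t x‖ₑ) g x} ^
              (1 / 2 : ℝ) ≤
            ENNReal.ofReal (C * t ^ (-α)) * (eLpNorm g 1 volume + eLpNorm g 2 volume)) := by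
  rcases lt_trichotomy (d : ℝ) (2 * β) with h | h | h
  · obtain ⟨C, hC, hZ⟩ := exists_eLpNorm_fundZ_le hα0 hα1 hβ0 hd h
    refine ⟨C, hC, fun g hg _ t ht => ⟨fun _ => ?_, fun h' => absurd h' h.ne⟩⟩
    rw [min_eq_right ((div_lt_one (by positivity)).2 h).le, lconv_comm]
    refine (eLpNorm_lconv_le hg (measurable_fundZ hβ0 hd t).enorm).trans ?_
    rw [mul_comm]
    exact mul_le_mul' (hZ t ht) le_self_add
  · obtain ⟨C, hC, hZ⟩ := exists_norm_fundZ_le_endpoint hα0 hα1 hβ0 hd h.ge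
    obtain ⟨A, hA0, hA⟩ := exists_weak_lconv_le hd
    refine ⟨A * C, by positivity, fun g hg hg1 t ht => ⟨fun h' => absurd h h', fun _ r => ?_⟩⟩
    have hp : β - d = -(d : ℝ) / 2 := by linarith
    rw [hp] at hZ
    refine (hA _ g (C * t ^ (-α)) (measurable_fundZ hβ0 hd t).enorm hg hg1 (by positivity)
      (hZ t ht) r).trans ?_
    rw [← mul_assoc, eLpNorm_one_eq_lintegral_enorm]
    exact mul_le_mul_right le_self_add _
  · obtain ⟨C, hC, hZ⟩ := exists_norm_fundZ_le_endpoint hα0 hα1 hβ0 hd h.le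
    obtain ⟨A, hA0, hA⟩ := exists_eLpNorm_lconv_le hd (p := β - d) (by linarith) (by linarith)
    refine ⟨A * C, by positivity, fun g hg _ t ht => ⟨fun _ => ?_, fun h' => absurd h' h.ne'⟩⟩
    rw [min_eq_left ((one_le_div (by positivity)).2 h.le), mul_one, mul_assoc]
    exact hA _ g (C * t ^ (-α)) (measurable_fundZ hβ0 hd t).enorm hg (by positivity) (hZ t ht)

theorem ae_lconv_fundZ_lt_top (hα0 : 0 < α) (hα1 : α < 1) (hβ0 : 0 < β) (hd : 1 ≤ d)
    {g : EuclideanSpace ℝ (Fin d) → ℝ≥0∞} (hg : Measurable g) (hg1 : ∫⁻ x, g x ≠ ∞) {t : ℝ}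
    (ht : 0 < t) : ∀ᵐ x, lconv volume (fun x => ‖fundZ α β t x‖ₑ) g x < ∞ := by
  have hc := contour_mem hβ0 hd
  have hc2 := hc.2.trans_le (min_le_right _ _)
  rw [lt_div_iff₀ hβ0] at hc2
  obtain ⟨C, hC, hZ⟩ := exists_norm_fundZ_le hd (exists_norm_foxH_Z_le hα0 hα1 hβ0 hd hc)
  have := mul_pos hβ0 hc.1
  exact ae_lconv_lt_top hd (measurable_fundZ hβ0 hd t).enorm hg hg1 (by positivity)
    (by linarith) (by linarith) fun x => enorm_fundZ_le (hZ t ht x)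

end Mild

end FullyNonlocal

end

theorem mainTheorem3 (α β : ℝ) (hα0 : 0 < α) (hα1 : α < 1) (hβ0 : 0 < β) (hβ2 : β ≤ 2)
    (d : ℕ) (hd : 1 ≤ d) :
    ∃ C : ℝ, 0 < C ∧ ∀ u₀ : EuclideanSpace ℝ (Fin d) → ℂ,
      MemLp u₀ 1 volume → MemLp u₀ 2 volume → ∀ t : ℝ, 0 < t →
        (∀ᵐ x, FullyNonlocal.MildDefinedAt α β u₀ 0 t x) ∧
        AEStronglyMeasurable (FullyNonlocal.mildSolution α β u₀ 0 t) volume ∧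
        ((d : ℝ) ≠ 2 * β →
          eLpNorm (FullyNonlocal.mildSolution α β u₀ 0 t) 2 volume ≤
            ENNReal.ofReal (C * t ^ (-(α * min 1 ((d : ℝ) / (2 * β))))) *
              (eLpNorm u₀ 1 volume + eLpNorm u₀ 2 volume)) ∧
        ((d : ℝ) = 2 * β →
          FullyNonlocal.weakLpNorm (FullyNonlocal.mildSolution α β u₀ 0 t) 2 ≤
            ENNReal.ofReal (C * t ^ (-α)) *
              (eLpNorm u₀ 1 volume + eLpNorm u₀ 2 volume)) := by
  obtain ⟨C, hC, h⟩ := FullyNonlocal.exists_mildSolution_bound hα0 hα1 hβ0 hd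
  refine ⟨C, hC, fun u₀ hu1 hu2 t ht => ?_⟩
  have hZ := FullyNonlocal.measurable_fundZ (α := α) hβ0 hd t
  -- The convolution estimates require measurable data, so `|u₀|` is replaced by a measurable
  -- representative, which changes neither the convolution nor the norms.
  have hm : AEMeasurable (fun y => ‖u₀ y‖ₑ) volume := hu1.1.enorm
  have hle := FullyNonlocal.enorm_mildSolution_le (α := α) (β := β) (u₀ := u₀) t
  have hg1 : ∫⁻ x, hm.mk _ x ≠ ⊤ := by
    rw [← lintegral_congr_ae hm.ae_eq_mk, ← eLpNorm_one_eq_lintegral_enorm]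
    exact hu1.2.ne
  have e1 : eLpNorm (hm.mk _) 1 volume = eLpNorm u₀ 1 volume := by
    rw [← eLpNorm_congr_ae hm.ae_eq_mk, eLpNorm_enorm]
  have e2 : eLpNorm (hm.mk _) 2 volume = eLpNorm u₀ 2 volume := by
    rw [← eLpNorm_congr_ae hm.ae_eq_mk, eLpNorm_enorm]
  have hb := h _ hm.measurable_mk hg1 t ht
  have hfin := FullyNonlocal.ae_lconv_fundZ_lt_top hα0 hα1 hβ0 hd hm.measurable_mk hg1 ht
  rw [e1, e2, ← FullyNonlocal.lconv_congr_ae hm.ae_eq_mk] at hb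
  rw [← FullyNonlocal.lconv_congr_ae hm.ae_eq_mk] at hfin
  refine ⟨hfin.mono fun x hx => FullyNonlocal.mildDefinedAt_of_lconv_lt_top hZ hu1.1 hx,
    FullyNonlocal.aestronglyMeasurable_mildSolution hZ hu1.1, fun hne => ?_, fun heq => ?_⟩
  · exact (eLpNorm_mono_enorm hle).trans (hb.1 hne)
  · exact FullyNonlocal.weakLpNorm_two_le hle (hb.2 heq)
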